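/- **Setting.** Let $(Z_t)_{t\in\mathbb R}$ be a Lévy process with $Z_0=0$ and $\mathbb E\,e^{iu(Z_t-Z_s)}=e^{(t-s)\psi_{\eta^*}(u)}$ for $s\le t$, where $\psi_\eta(u)=ib(\eta)u+\int(e^{iux}-1)\,\nu(dx,\eta)$ and, for every $\eta$ in an open set $G_\eta\subset\mathbb R^r$, $\nu(\cdot,\eta)$ is a Lévy measure with $\int\min(|x|,1)\,\nu(dx,\eta)<\infty$. Fix $h>0$ and let $\Delta Z_n=Z_{nh}-Z_{(n-1)h}$ $(n\in\mathbb Z)$ and $\varphi(u,\eta)=e^{h\psi_\eta(u)}$. The scalar observations $\Delta y_1,\Delta y_2,\dots$ satisfy $$X_{n+1}=H(\theta^*)X_n+K(\theta^*)\Delta Z_n,\qquad \Delta y_n=L(\theta^*)X_n+\Delta Z_n\qquad(n\ge1),$$ where the initial state $X_1$ is any random vector with finite moments of all orders (for example $0$, or the stationary state). The sets $D_\theta,D_\theta^*\subset\mathbb R^p$ and $D_\eta,D_\eta^*\subset\mathbb R^r$ are compact, $\theta^*\in D^*_\theta\subset\operatorname{int}D_\theta$, $D_\theta\subset G_\theta\subset\mathbb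 R^p$, $\eta^*\in D^*_\eta\subset\operatorname{int}D_\eta$, $D_\eta\subset G_\eta$. The matrices $H,K,L$ depend continuously on $\theta\in D_\theta$. Let $\varepsilon_n(\theta)$, $n\ge 1$, be the estimated innovations, i.e. the output of the inverse system $\hat X_{n+1}=(H(\theta)-K(\theta)L(\theta))\hat X_n+K(\theta)\Delta y_n$, $\varepsilon_n(\theta)=\Delta y_n-L(\theta)\hat X_n$, $\hat X_1=0$. Let $\varepsilon_n^{(s)}(\theta)$ be its stationary version, obtained by applying the inverse filter with parameter $\theta$, started at $-\infty$, to the stationary output of the system with parameter $\theta^*$ driven by $(\Delta Z_n)_{n\in\mathbb Z}$. Fix real numbers $u_1,\dots,u_M$ such that $\eta\mapsto\varphi(u_k,\eta)$ is twice continuously differentiable on $G_\eta$ for each $k$, and a Hermitian positive definite $M\times M$ matrix $\mathbf K$. Write $|\mathbf K^{-1/2}v|^2=v^*\mathbf K^{-1}v$ and $$h_{n}(\theta,\eta)=\big(e^{iu_k\varepsilon_n(\theta)}-\varphi(u_k,\eta)\big)_{k=1}^M,\qquad h_{n}^{(s)}(\theta,\eta)=\big(e^{iu_k\varepsilon^{(s)}_n(\theta)}-\varphi(u_k,\eta)\big)_{k=1}^M,$$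 $$V_{E,N}(\theta,\eta)=\Big|\mathbf K^{-1/2}\frac1N\sum_{n=1}^Nh_n(\theta,\eta)\Big|^2,\qquad W_E(\theta,\eta)=\mathbb E\big|\mathbf K^{-1/2}h^{(s)}_n(\theta,\eta)\big|^2 .$$ **Conditions.** 1. For all $\theta\in G_\theta$, all eigenvalues of $H(\theta)$ and of $H(\theta)-K(\theta)L(\theta)$ lie in the open unit disc. 2. $\int_{|x|\ge1}|x|^q\,\nu(dx,\eta^*)<\infty$ for all $q\ge1$, and $\mathbb E[\Delta Z_n]=0$. 3. For each $\theta\in D_\theta$ the equation $W_{E,\eta}(\theta,\eta)=0$ has exactly one solution $\eta=\eta^*(\theta)$ in $D_\eta$; it lies in $D^*_\eta$, and the Hessian $W_{E,\eta\eta}(\theta,\eta^*(\theta))$ is nonsingular. For $N\ge1$ and $\theta\in D_\theta$, let $\hat\eta_N(\theta)$ be any $D_\eta$-valued random vector that solves $V_{E,N,\eta}(\theta,\eta)=0$ whenever this equation has a solution in $D_\eta$. **Lemma.** Under Conditions 1, 2 and 3, $\hat\eta_N(\theta)-\eta^*(\theta)=O_M(N^{-1/2})$ uniformly in $\theta\in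 D_\theta$; that is, for every $q\ge1$, $$\sup_{N\ge1,\ \theta\in D_\theta}N^{1/2}\,\mathbb E^{1/q}\big|\hat\eta_N(\theta)-\eta^*(\theta)\big|^q<\infty .$$ -/

import Mathlib

open MeasureTheory ProbabilityTheory Filter Topology
open scoped ComplexOrder

noncomputable section

namespace LevyECF

/-! ### Pure-jump Lévy processes -/

/-- `ν` is a Lévy measure of finite variation type: no mass at `0`, `∫ min(|x|,1) ν(dx) < ∞`. -/
structure IsLevyMeasure (ν : Measure ℝ) : Prop where
  zero : ν {0} = 0
  integrable : ∫⁻ x, ENNReal.ofReal (min |x| 1) ∂ν < ⊤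

/-- Characteristic exponent `ψ(u) = i b u + ∫ (e^{iux} - 1) ν(dx)`. -/
def charExponent (b : ℝ) (ν : Measure ℝ) (u : ℝ) : ℂ :=
  Complex.I * b * u + ∫ x : ℝ, (Complex.exp (Complex.I * u * x) - 1) ∂ν

/-- `Z` is a Lévy process with time set `ℝ` and `Z_0 = 0`, having drift `b` and
Lévy measure `ν`: càdlàg paths, independent increments, and stationary increments with
`E e^{iu(Z_t - Z_s)} = e^{(t-s) ψ(u)}`. -/
structure IsLevyProcess {Ω : Type*} [MeasurableSpace Ω] (P : Measure Ω)
    (Z : ℝ → Ω → ℝ) (b : ℝ) (ν : Measure ℝ) : Prop where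
  measurable : ∀ t, Measurable (Z t)
  zero : ∀ᵐ ω ∂P, Z 0 ω = 0
  cadlag : ∀ᵐ ω ∂P, ∀ t, ContinuousWithinAt (fun s => Z s ω) (Set.Ici t) t ∧
    ∃ l, Tendsto (fun s => Z s ω) (𝓝[<] t) (𝓝 l)
  indep : HasIndepIncrements Z P
  charFun : ∀ s t : ℝ, s ≤ t → ∀ u : ℝ,
    ∫ ω, Complex.exp (Complex.I * u * ((Z t ω - Z s ω : ℝ) : ℂ)) ∂P =
      Complex.exp (((t - s : ℝ) : ℂ) * charExponent b ν u)

/-- The increment `ΔZ_n = Z_{nh} - Z_{(n-1)h}`, `n ∈ ℤ`. -/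
def increment {Ω : Type*} (Z : ℝ → Ω → ℝ) (h : ℝ) (n : ℤ) (ω : Ω) : ℝ :=
  Z (n * h) ω - Z ((n - 1) * h) ω

/-! ### The linear system in innovation form -/

/-- The matrices of the single-input single-output innovation form
`X_{n+1} = H(θ) X_n + K(θ) ΔZ_n`, `Δy_n = L(θ) X_n + ΔZ_n` with `d`-dimensional state. -/
structure InnovationModel (Θ : Type*) (d : ℕ) where
  H : Θ → Matrix (Fin d) (Fin d) ℝ
  K : Θ → Fin d → ℝ
  L : Θ → Fin d → ℝ

/-- All complex eigenvalues lie in the open unit disc. -/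
def IsStable {d : ℕ} (A : Matrix (Fin d) (Fin d) ℝ) : Prop :=
  ∀ z ∈ spectrum ℂ (A.map (fun x : ℝ => (x : ℂ))), ‖z‖ < 1

namespace InnovationModel

variable {Θ Ω : Type*} {d : ℕ}

/-- The state matrix `H(θ) - K(θ) L(θ)` of the inverse system. -/
def invH (S : InnovationModel Θ d) (θ : Θ) : Matrix (Fin d) (Fin d) ℝ :=
  S.H θ - Matrix.vecMulVec (S.K θ) (S.L θ)

/-- `state S θ x₁ e k` is the state `X_{k+1}` at time `k+1` of the system with parameter `θ`,
driven by `e` and started from the state `x₁` at time `1`. -/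
def state (S : InnovationModel Θ d) (θ : Θ) (x₁ : Fin d → ℝ) (e : ℤ → ℝ) : ℕ → Fin d → ℝ
  | 0 => x₁
  | k + 1 => (S.H θ).mulVec (state S θ x₁ e k) + e ((k : ℤ) + 1) • S.K θ

/-- The observation `Δy_{k+1}` at time `k+1`. -/
def output (S : InnovationModel Θ d) (θ : Θ) (x₁ : Fin d → ℝ) (e : ℤ → ℝ) (k : ℕ) : ℝ :=
  S.L θ ⬝ᵥ S.state θ x₁ e k + e ((k : ℤ) + 1)

/-- State at time `k+1` of the inverse system `x_{n+1} = (H - K L) x_n + K y_n`, fed with the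
observations `y k` (at time `k+1`) and started from zero. -/
def invState (S : InnovationModel Θ d) (θ : Θ) (y : ℕ → ℝ) : ℕ → Fin d → ℝ
  | 0 => 0
  | k + 1 => (S.invH θ).mulVec (invState S θ y k) + y k • S.K θ

/-- The estimated innovation `ε_{k+1}(θ) = (A(θ)⁻¹ y)_{k+1}`, with zero initialization. -/
def innovation (S : InnovationModel Θ d) (θ : Θ) (y : ℕ → ℝ) (k : ℕ) : ℝ :=
  y k - S.L θ ⬝ᵥ S.invState θ y k

/-- The stationary output `A(θ) e`, i.e. the filter started at `-∞`:
`y_n = e_n + ∑_{j ≥ 0} L H^j K e_{n-1-j}`. -/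
def statOutput (S : InnovationModel Θ d) (θ : Θ) (e : ℤ → ℝ) (n : ℤ) : ℝ :=
  e n + ∑' j : ℕ, (S.L θ ⬝ᵥ (S.H θ ^ j).mulVec (S.K θ)) * e (n - 1 - j)

/-- The inverse filter `A(θ)⁻¹ y` started at `-∞`:
`ε_n = y_n - ∑_{j ≥ 0} L (H - K L)^j K y_{n-1-j}`. -/
def statInverse (S : InnovationModel Θ d) (θ : Θ) (y : ℤ → ℝ) (n : ℤ) : ℝ :=
  y n - ∑' j : ℕ, (S.L θ ⬝ᵥ (S.invH θ ^ j).mulVec (S.K θ)) * y (n - 1 - j)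

end InnovationModel

/-! ### The empirical characteristic function criterion -/

/-- Weighted norm `|K^{-1/2} v|² = v* K⁻¹ v`. -/
def weightedSq {M : ℕ} (K : Matrix (Fin M) (Fin M) ℂ) (v : Fin M → ℂ) : ℝ :=
  (star v ⬝ᵥ K⁻¹.mulVec v).re

/-- Characteristic function `φ(u, η)` of an increment over a time step of length `h`, for the
noise family with drift `b η` and Lévy measure `ν η`. -/
def noiseCF {Η : Type*} (b : Η → ℝ) (ν : Η → Measure ℝ) (h : ℝ) (u : ℝ) (η : Η) : ℂ :=
  Complex.exp ((h : ℂ) * charExponent (b η) (ν η) u)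

/-- The score `h_k = e^{i u_k ε} - φ(u_k, η)`, `k = 1, …, M`. -/
def score {Η : Type*} {M : ℕ} (φ : ℝ → Η → ℂ) (u : Fin M → ℝ) (ε : ℝ) (η : Η) : Fin M → ℂ :=
  fun k => Complex.exp (Complex.I * u k * ε) - φ (u k) η

/-- The cost `V_{E,N} = |K^{-1/2} h̄_N|²`, where `h̄_N` is the average of the scores at the
estimated innovations `ε_1, …, ε_N` (here `ε k` stands for `ε_{k+1}`). -/
def empiricalCost {Η : Type*} {M : ℕ} (φ : ℝ → Η → ℂ) (u : Fin M → ℝ)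
    (K : Matrix (Fin M) (Fin M) ℂ) (N : ℕ) (ε : ℕ → ℝ) (η : Η) : ℝ :=
  weightedSq K ((N : ℂ)⁻¹ • ∑ k ∈ Finset.range N, score φ u (ε k) η)

/-- The asymptotic cost `W_E = E |K^{-1/2} h⁽ˢ⁾_n|²`, where `ε` is the stationary innovation
`ε⁽ˢ⁾_n(θ)` at a fixed time. -/
def asymptoticCost {Ω Η : Type*} [MeasurableSpace Ω] (P : Measure Ω) {M : ℕ}
    (φ : ℝ → Η → ℂ) (u : Fin M → ℝ) (K : Matrix (Fin M) (Fin M) ℂ) (ε : Ω → ℝ) (η : Η) : ℝ :=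
  ∫ ω, weightedSq K (score φ u (ε ω) η) ∂P

/-- `η̂` is a gradient-equation estimator over the compact set `D`: a `D`-valued random vector that
solves `∇V(η) = 0` whenever this equation has a solution in `D`. Here `V ω η` is the cost. -/
structure IsGradientEstimator {Ω Η : Type*} [MeasurableSpace Ω] [NormedAddCommGroup Η]
    [InnerProductSpace ℝ Η] [CompleteSpace Η] [MeasurableSpace Η]
    (V : Ω → Η → ℝ) (D : Set Η) (ηhat : Ω → Η) : Prop where
  measurable : Measurable ηhat
  mem : ∀ ω, ηhat ω ∈ D
  root : ∀ ω, (∃ η ∈ D, gradient (V ω) η = 0) → gradient (V ω) (ηhat ω) = 0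

/-- Compact sets `Dstar`, `D` with `x ∈ Dstar ⊆ int D` and `D ⊆ G`. -/
structure IsDomainChain {E : Type*} [TopologicalSpace E] (G D Dstar : Set E) (x : E) : Prop where
  compact : IsCompact D
  compact_star : IsCompact Dstar
  mem : x ∈ Dstar
  subset_interior : Dstar ⊆ interior D
  subset : D ⊆ G

/-- `X_N(θ) = O_M(f(N))`, uniformly for `θ ∈ D`: for every real `q ≥ 1`,
`sup_{N ≥ 1, θ ∈ D} E^{1/q}|X_N(θ)|^q / f(N) < ∞`. -/
def IsOM {Ω Θ E : Type*} [MeasurableSpace Ω] [NormedAddCommGroup E] (P : Measure Ω)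
    (D : Set Θ) (X : ℕ → Θ → Ω → E) (f : ℕ → ℝ) : Prop :=
  ∀ q : ℝ, 1 ≤ q → ∃ C : ℝ, ∀ N : ℕ, 1 ≤ N → ∀ θ ∈ D,
    eLpNorm (X N θ) (ENNReal.ofReal q) P ≤ ENNReal.ofReal (C * f N)

end LevyECF

end

open LevyECF

namespace LevyECF

/-! ### Uniform geometric decay of matrix powers over a compact parameter set -/

section Stability

attribute [local instance] Matrix.linftyOpNormedRing Matrix.linftyOpNormedAlgebra
  Matrix.linftyOpNormedAddCommGroup Matrix.linftyOpNormedSpace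

/-! The data enter the empirical cost only through the vector `w` of averages of `exp(i u_k
ε_n(θ))`: the cost is a fixed function `misfit K φ u (w, η)`. By the bias-variance identity
`integral_weightedSq_sub`, the asymptotic cost is `misfit K φ u (m θ, η)` plus a term free of `η`,
where `m θ` is the characteristic function of the stationary innovation at the nodes. Both gradient
equations are therefore instances of a single equation `misfitGrad K φ u (v, η) = 0`, at `v = w` and
at `v = m θ`.

This separates the problem into a deterministic and a probabilistic half. Deterministically
(`exists_dist_zero_le`), the nondegenerate unique zeros at `m θ`, `θ ∈ Dθ`, and the compactness of
`m '' Dθ` give `‖η - ηstar θ‖ ≤ C ‖w - m θ‖` for every `w` and every admissible `η`. When `w` is far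
from `m θ` and no root need exist, boundedness of `Dη` suffices, so no event of small probability
has to be discarded.

Probabilistically, it remains to bound `‖w - m θ‖` in `L^q` by a multiple of `N^{-1/2}`, uniformly
in `θ`. Up to an exponentially small effect of the initial state, the innovation is a moving average
of i.i.d. noise with coefficients bounded by `C ρ^l`, with `C, ρ` common to all `θ ∈ Dθ`
(`exists_filterBounds`). In `exists_eLpNorm_centered_filtSum_le`, a bounded Lipschitz function of
the moving average is telescoped over the truncation length `j`. The `j`-th difference depends on `j
+ 1` consecutive noise variables, so along a residue class modulo `j + 1` the differences are
independent. A moment inequality linear in the variance (`exists_integral_sum_pow_le`) gives each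
class an `L^{2q+2}` norm of order `√N τ^j` with `τ < 1`, and `∑ (j + 1) τ^j` converges. Since
`exp(iux)` is bounded and Lipschitz, only first absolute moments of the noise enter; they are finite
because the characteristic function satisfies `1 - Re φ(u) = O(u²)` at the origin. -/

lemma exists_norm_pow_lt {d : ℕ} {A : Matrix (Fin d) (Fin d) ℝ} (hA : IsStable A) :
    ∃ n : ℕ, 0 < n ∧ ‖A ^ n‖ < 1 / 2 := by
  rcases Nat.eq_zero_or_pos d with rfl | hd
  · refine ⟨1, one_pos, ?_⟩
    rw [Subsingleton.elim (A ^ 1) 0, norm_zero]; norm_num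
  have : Nonempty (Fin d) := ⟨⟨0, hd⟩⟩
  set B : Matrix (Fin d) (Fin d) ℂ := A.map (fun x : ℝ => (x : ℂ)) with hB
  have hspec : spectralRadius ℂ B < 1 := by
    have := spectrum.spectralRadius_lt_of_forall_lt B (r := 1)
      (fun k hk => by have := hA k hk; exact_mod_cast this)
    simpa using this
  have hlim := spectrum.pow_nnnorm_pow_one_div_tendsto_nhds_spectralRadius B
  obtain ⟨r, hr1, hr2⟩ := ENNReal.lt_iff_exists_nnreal_btwn.1 hspec
  have hr2' : r < 1 := by exact_mod_cast hr2
  have h1 := hlim.eventually_lt_const hr1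
  have h2 : ∀ᶠ n : ℕ in atTop, r ^ n < 1 / 2 :=
    (tendsto_pow_atTop_nhds_zero_of_lt_one (zero_le) hr2').eventually_lt_const (by norm_num)
  obtain ⟨n, hn1, hn2, hn3⟩ := (h1.and (h2.and (eventually_gt_atTop 0))).exists
  refine ⟨n, hn3, ?_⟩
  -- Gelfand's formula is applied to the complexification; the maximal row sum norm depends only on
  -- the moduli of the entries, so it is the same for the real matrix.
  have hBA : ‖A ^ n‖₊ = ‖B ^ n‖₊ := by
    have : B ^ n = (A ^ n).map (fun x : ℝ => (x : ℂ)) :=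
      (map_pow (Complex.ofRealHom.mapMatrix) A n).symm
    rw [this, Matrix.linfty_opNNNorm_def, Matrix.linfty_opNNNorm_def]
    simp
  have h3 : (‖B ^ n‖₊ : ENNReal) ≤ (r : ENNReal) ^ n := by
    have := ENNReal.rpow_le_rpow hn1.le (Nat.cast_nonneg n : (0:ℝ) ≤ n)
    rw [← ENNReal.rpow_mul, one_div, inv_mul_cancel₀ (by positivity), ENNReal.rpow_one,
      ENNReal.rpow_natCast] at this
    exact this
  have h4 : ‖B ^ n‖₊ ≤ r ^ n := by exact_mod_cast h3
  have h5 : ‖A ^ n‖₊ < 1 / 2 := by rw [hBA]; exact h4.trans_lt hn2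
  exact_mod_cast h5

/-- Factors `A ^ n` are peeled off until the exponent is below `n`; the division by `τ ^ n` pays for
these first exponents, where `τ ^ j ≥ τ ^ n`. -/
lemma norm_pow_le_of_norm_pow_le {R : Type*} [NormedRing R] (A : R) {n : ℕ} (hn : 0 < n)
    {τ B : ℝ} (hτ0 : 0 < τ) (hτ1 : τ ≤ 1) (hA : ‖A ^ n‖ ≤ τ ^ n) (hB : ∀ i < n, ‖A ^ i‖ ≤ B)
    (j : ℕ) : ‖A ^ j‖ ≤ B / τ ^ n * τ ^ j := by
  have hB0 : 0 ≤ B := (norm_nonneg _).trans (hB 0 hn)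
  induction j using Nat.strong_induction_on with
  | _ j ih =>
    rcases lt_or_ge j n with hj | hj
    · refine (hB j hj).trans ?_
      rw [div_mul_eq_mul_div, le_div_iff₀ (by positivity)]
      exact mul_le_mul_of_nonneg_left (pow_le_pow_of_le_one hτ0.le hτ1 hj.le) hB0
    · obtain ⟨k, rfl⟩ := Nat.exists_eq_add_of_le hj
      rw [pow_add, pow_add]
      refine (norm_mul_le _ _).trans ?_
      calc ‖A ^ n‖ * ‖A ^ k‖ ≤ τ ^ n * (B / τ ^ n * τ ^ k) :=
            mul_le_mul hA (ih k (by omega)) (norm_nonneg _) (by positivity)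
        _ = _ := by ring

/-- The condition `‖A x ^ n‖ < 1/2` for one fixed `n` is open in `x` and already forces geometric
decay, so the bound holds locally with common constants, and compactness makes it global. -/
lemma exists_uniform_norm_pow_le {E : Type*} [TopologicalSpace E] {d : ℕ} {D : Set E}
    (hD : IsCompact D) {A : E → Matrix (Fin d) (Fin d) ℝ} (hA : ContinuousOn A D)
    (hst : ∀ x ∈ D, IsStable (A x)) :
    ∃ C ρ : ℝ, 0 < C ∧ 0 < ρ ∧ ρ < 1 ∧ ∀ x ∈ D, ∀ j : ℕ, ‖A x ^ j‖ ≤ C * ρ ^ j := by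
  refine hD.induction_on (p := fun s => ∃ C ρ : ℝ, 0 < C ∧ 0 < ρ ∧ ρ < 1 ∧
    ∀ x ∈ s, ∀ j : ℕ, ‖A x ^ j‖ ≤ C * ρ ^ j) ?_ ?_ ?_ ?_
  · exact ⟨1, 1 / 2, by norm_num, by norm_num, by norm_num, by simp⟩
  · rintro s t hst ⟨C, ρ, h1, h2, h3, h4⟩
    exact ⟨C, ρ, h1, h2, h3, fun x hx => h4 x (hst hx)⟩
  · rintro s t ⟨C, ρ, h1, h2, h3, h4⟩ ⟨C', ρ', h1', h2', h3', h4'⟩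
    refine ⟨max C C', max ρ ρ', lt_max_of_lt_left h1, lt_max_of_lt_left h2, max_lt h3 h3', ?_⟩
    rintro x (hx | hx) j
    · refine (h4 x hx j).trans ?_
      gcongr
      exacts [le_max_left _ _, le_max_left _ _]
    · refine (h4' x hx j).trans ?_
      gcongr
      exacts [le_max_right _ _, le_max_right _ _]
  · intro x hx
    obtain ⟨n, hn, hlt⟩ := exists_norm_pow_lt (hst x hx)
    have hcont : ∀ i : ℕ, ContinuousWithinAt (fun y => ‖A y ^ i‖) D x := fun i =>
      ((hA x hx).pow i).norm
    set B : ℝ := ∑ i ∈ Finset.range n, ‖A x ^ i‖ + 1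
    have hev : ∀ᶠ y in 𝓝[D] x, ‖A y ^ n‖ < 1 / 2 ∧ ∀ i ∈ Finset.range n, ‖A y ^ i‖ < B := by
      refine ((hcont n).eventually_lt_const hlt).and ?_
      refine (Finset.eventually_all _).2 fun i hi => (hcont i).eventually_lt_const ?_
      have := Finset.single_le_sum (f := fun i => ‖A x ^ i‖) (fun i _ => norm_nonneg _) hi
      simp only [B]; linarith
    set τ : ℝ := (1 / 2 : ℝ) ^ ((n : ℝ)⁻¹)
    have hτn : τ ^ n = 1 / 2 := Real.rpow_inv_natCast_pow (by norm_num) hn.ne'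
    have hτ0 : 0 < τ := Real.rpow_pos_of_pos (by norm_num) _
    have hτ1 : τ < 1 := Real.rpow_lt_one (by norm_num) (by norm_num) (by positivity)
    have hB : 0 < B := by positivity
    refine ⟨_, hev, B / τ ^ n, τ, by positivity, hτ0, hτ1, fun y hy j => ?_⟩
    exact norm_pow_le_of_norm_pow_le (A y) hn hτ0 hτ1.le (hτn ▸ hy.1.le)
      (fun i hi => (hy.2 i (Finset.mem_range.2 hi)).le) j

lemma exists_uniform_norm_mulVec_le {E : Type*} [TopologicalSpace E] {d : ℕ} {D : Set E}
    (hD : IsCompact D) {A : E → Matrix (Fin d) (Fin d) ℝ} (hA : ContinuousOn A D)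
    (hst : ∀ x ∈ D, IsStable (A x)) {L : E → Fin d → ℝ} (hL : ContinuousOn L D) :
    ∃ C ρ : ℝ, 0 < C ∧ 0 < ρ ∧ ρ < 1 ∧
      ∀ x ∈ D, ∀ j : ℕ, ∀ v, |L x ⬝ᵥ (A x ^ j).mulVec v| ≤ C * ρ ^ j * ‖v‖ := by
  obtain ⟨C, ρ, h1, h2, h3, h4⟩ := exists_uniform_norm_pow_le hD hA hst
  obtain ⟨B, hB⟩ := hD.exists_bound_of_continuousOn hL
  refine ⟨d * (|B| + 1) * C + 1, ρ, by positivity, h2, h3, fun x hx j v => ?_⟩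
  have hmv : ‖(A x ^ j).mulVec v‖ ≤ C * ρ ^ j * ‖v‖ :=
    (Matrix.linfty_opNorm_mulVec _ _).trans (mul_le_mul_of_nonneg_right (h4 x hx j) (norm_nonneg _))
  calc |L x ⬝ᵥ (A x ^ j).mulVec v| ≤ ∑ i, |L x i * (A x ^ j).mulVec v i| :=
        Finset.abs_sum_le_sum_abs _ _
    _ ≤ ∑ i : Fin d, (|B| + 1) * (C * ρ ^ j * ‖v‖) := by
        refine Finset.sum_le_sum fun i _ => ?_
        rw [abs_mul]
        refine mul_le_mul ?_ ((norm_le_pi_norm _ i).trans hmv) (abs_nonneg _) (by positivity)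
        exact (norm_le_pi_norm (L x) i).trans ((hB x hx).trans (by linarith [le_abs_self B]))
    _ = d * (|B| + 1) * C * ρ ^ j * ‖v‖ := by simp; ring
    _ ≤ _ := by gcongr; linarith

end Stability

/-! ### Impulse responses and the composition of system and inverse filter -/

namespace InnovationModel

variable {Θ : Type*} {d : ℕ}

/-- Impulse response of the system. -/
noncomputable def outCoeff (S : InnovationModel Θ d) (θ : Θ) : ℕ → ℝ
  | 0 => 1
  | j + 1 => S.L θ ⬝ᵥ (S.H θ ^ j).mulVec (S.K θ)

/-- Impulse response of the inverse system. -/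
noncomputable def invCoeff (S : InnovationModel Θ d) (θ : Θ) : ℕ → ℝ
  | 0 => 1
  | j + 1 => -(S.L θ ⬝ᵥ (S.invH θ ^ j).mulVec (S.K θ))

/-- Impulse response of the system with parameter `θ'` followed by the inverse system with
parameter `θ`. -/
noncomputable def filtCoeff (S : InnovationModel Θ d) (θ θ' : Θ) (l : ℕ) : ℝ :=
  ∑ p ∈ Finset.HasAntidiagonal.antidiagonal l, S.invCoeff θ p.1 * S.outCoeff θ' p.2

/-- Variation of constants, used for both the system and its inverse. -/
lemma dotProduct_linear_recursion {A : Matrix (Fin d) (Fin d) ℝ} {v L : Fin d → ℝ} {w : ℕ → ℝ}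
    {x : ℕ → Fin d → ℝ} (hx : ∀ k, x (k + 1) = A.mulVec (x k) + w k • v) (k : ℕ) :
    L ⬝ᵥ x k = L ⬝ᵥ (A ^ k).mulVec (x 0) +
      ∑ i ∈ Finset.range k, (L ⬝ᵥ (A ^ i).mulVec v) * w (k - 1 - i) := by
  have key : ∀ k, x k = (A ^ k).mulVec (x 0) +
      ∑ i ∈ Finset.range k, w (k - 1 - i) • (A ^ i).mulVec v := by
    intro k
    induction k with
    | zero => simp
    | succ k ih =>
      rw [hx, ih, Matrix.mulVec_add, Matrix.mulVec_mulVec, ← pow_succ', Finset.sum_range_succ',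
        Matrix.mulVec_sum, add_assoc]
      congr 2
      · refine Finset.sum_congr rfl fun i _ => ?_
        rw [Matrix.mulVec_smul, Matrix.mulVec_mulVec, ← pow_succ']
        congr 2; omega
      · simp
  rw [key, dotProduct_add, dotProduct_sum]
  congr 1
  exact Finset.sum_congr rfl fun i _ => by rw [dotProduct_smul, smul_eq_mul, mul_comm]

lemma output_eq (S : InnovationModel Θ d) (θ : Θ) (x₁ : Fin d → ℝ) (e : ℤ → ℝ) (k : ℕ) :
    S.output θ x₁ e k = ∑ i ∈ Finset.range (k + 1), S.outCoeff θ i * e ((k : ℤ) + 1 - i) +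
      S.L θ ⬝ᵥ (S.H θ ^ k).mulVec x₁ := by
  rw [output, dotProduct_linear_recursion (A := S.H θ) (v := S.K θ) (L := S.L θ)
    (w := fun k : ℕ => e ((k : ℤ) + 1)) (x := S.state θ x₁ e) (fun k => rfl),
    Finset.sum_range_succ']
  have : ∀ i ∈ Finset.range k, (S.L θ ⬝ᵥ (S.H θ ^ i).mulVec (S.K θ)) *
      e (((k - 1 - i : ℕ) : ℤ) + 1) = S.outCoeff θ (i + 1) * e ((k : ℤ) + 1 - ((i + 1 : ℕ) : ℤ)) := by
    intro i hi
    have := Finset.mem_range.1 hi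
    rw [outCoeff]; congr 2; omega
  rw [Finset.sum_congr rfl this]
  simp only [state, outCoeff]
  simp; ring

lemma innovation_eq_sum (S : InnovationModel Θ d) (θ : Θ) (y : ℕ → ℝ) (k : ℕ) :
    S.innovation θ y k = ∑ i ∈ Finset.range (k + 1), S.invCoeff θ i * y (k - i) := by
  rw [innovation, dotProduct_linear_recursion (A := S.invH θ) (v := S.K θ) (L := S.L θ)
    (w := y) (x := S.invState θ y) (fun k => rfl), Finset.sum_range_succ']
  have : ∀ i ∈ Finset.range k, S.invCoeff θ (i + 1) * y (k - (i + 1)) =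
      -((S.L θ ⬝ᵥ (S.invH θ ^ i).mulVec (S.K θ)) * y (k - 1 - i)) := by
    intro i hi
    rw [invCoeff, show k - (i + 1) = k - 1 - i by omega]; ring
  rw [Finset.sum_congr rfl this, Finset.sum_neg_distrib]
  simp [invState, invCoeff]; ring

/-- Convolving two causal filters started at the same time truncates the composite filter at `k + 1`
terms and changes none of its coefficients. The second sum is the response to the initial state. -/
lemma innovation_output_eq (S : InnovationModel Θ d) (θ θ' : Θ) (x₁ : Fin d → ℝ) (e : ℤ → ℝ)
    (k : ℕ) :
    S.innovation θ (S.output θ' x₁ e) k =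
      ∑ l ∈ Finset.range (k + 1), S.filtCoeff θ θ' l * e ((k : ℤ) + 1 - l) +
      ∑ i ∈ Finset.range (k + 1),
        S.invCoeff θ i * (S.L θ' ⬝ᵥ (S.H θ' ^ (k - i)).mulVec x₁) := by
  rw [innovation_eq_sum]
  simp_rw [output_eq, mul_add, Finset.sum_add_distrib]
  congr 1
  have h1 := Finset.sum_range_diag_flip (k + 1)
    (fun i j => S.invCoeff θ i * S.outCoeff θ' j * e ((k : ℤ) + 1 - (i + j : ℕ)))
  have h2 : ∀ l ∈ Finset.range (k + 1), S.filtCoeff θ θ' l * e ((k : ℤ) + 1 - l) =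
      ∑ i ∈ Finset.range (l + 1),
        S.invCoeff θ i * S.outCoeff θ' (l - i) * e ((k : ℤ) + 1 - (i + (l - i) : ℕ)) := by
    intro l _
    rw [filtCoeff, Finset.Nat.sum_antidiagonal_eq_sum_range_succ
      (fun i j => S.invCoeff θ i * S.outCoeff θ' j), Finset.sum_mul]
    refine Finset.sum_congr rfl fun i hi => ?_
    have := Finset.mem_range.1 hi
    rw [Nat.add_sub_cancel' (by omega)]
  rw [Finset.sum_congr rfl h2, h1]
  refine Finset.sum_congr rfl fun i hi => ?_
  have := Finset.mem_range.1 hi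
  rw [Finset.mul_sum, show k - i + 1 = k + 1 - i by omega]
  refine Finset.sum_congr rfl fun j _ => ?_
  rw [mul_assoc]; congr 3; push_cast [Nat.cast_sub (show i ≤ k by omega)]; ring

/-- The double series converges absolutely under `he`, so it may be summed along antidiagonals,
which is where `filtCoeff` appears. -/
lemma statInverse_statOutput_eq (S : InnovationModel Θ d) (θ θ' : Θ) {C ρ : ℝ} (hρ : 0 < ρ)
    (hb : ∀ j, |S.invCoeff θ j| ≤ C * ρ ^ j) (ha : ∀ j, |S.outCoeff θ' j| ≤ C * ρ ^ j)
    {e : ℤ → ℝ}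
    (he : Summable fun p : ℕ × ℕ => ρ ^ (p.1 + p.2) * |e (1 - ((p.1 + p.2 : ℕ) : ℤ))|) :
    S.statInverse θ (S.statOutput θ' e) 1 = ∑' l : ℕ, S.filtCoeff θ θ' l * e (1 - (l : ℤ)) := by
  have hC : 0 ≤ C := by have := (abs_nonneg _).trans (hb 0); simpa using this
  have hy : ∀ i : ℕ, Summable (fun j : ℕ => S.outCoeff θ' j * e (1 - (i : ℤ) - j)) := by
    intro i
    refine Summable.of_norm_bounded (g := fun j : ℕ => C / ρ ^ i *
      (ρ ^ (i + j) * |e (1 - ((i + j : ℕ) : ℤ))|)) ((he.prod_factor i).mul_left _) fun j => ?_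
    rw [Real.norm_eq_abs, abs_mul]
    calc _ ≤ (C * ρ ^ j) * |e (1 - (i : ℤ) - j)| := by gcongr; exact ha j
      _ = _ := by
        rw [show (1 - (i : ℤ) - j) = 1 - ((i + j : ℕ) : ℤ) by push_cast; ring, pow_add]
        field_simp
  have hout : ∀ i : ℕ, S.statOutput θ' e (1 - (i : ℤ)) =
      ∑' j : ℕ, S.outCoeff θ' j * e (1 - (i : ℤ) - j) := by
    intro i
    rw [(hy i).tsum_eq_zero_add, statOutput]
    congr 1
    · simp [outCoeff]
    · refine tsum_congr fun j => ?_
      rw [outCoeff]; congr 2; push_cast; ring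
  set F : ℕ × ℕ → ℝ := fun p =>
    S.invCoeff θ p.1 * S.outCoeff θ' p.2 * e (1 - ((p.1 + p.2 : ℕ) : ℤ)) with hF
  have hFs : Summable F := by
    refine Summable.of_norm_bounded (he.mul_left (C * C)) fun p => ?_
    simp only [hF]
    rw [Real.norm_eq_abs, abs_mul, abs_mul]
    calc _ ≤ (C * ρ ^ p.1) * (C * ρ ^ p.2) * |e (1 - ((p.1 + p.2 : ℕ) : ℤ))| := by
          gcongr
          exacts [hb _, ha _]
      _ = _ := by rw [pow_add]; ring
  have hFi : ∀ i, ∑' j, F (i, j) = S.invCoeff θ i * S.statOutput θ' e (1 - (i : ℤ)) := by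
    intro i
    rw [hout, ← tsum_mul_left]
    refine tsum_congr fun j => ?_
    simp only [hF]
    rw [mul_assoc, show (1 - (i : ℤ) - j) = 1 - ((i + j : ℕ) : ℤ) by push_cast; ring]
  have h1 : S.statInverse θ (S.statOutput θ' e) 1 = ∑' i, ∑' j, F (i, j) := by
    rw [hFs.prod.tsum_eq_zero_add]
    simp_rw [hFi]
    rw [statInverse, sub_eq_add_neg, ← tsum_neg]
    congr 1
    · simp [invCoeff]
    · refine tsum_congr fun j => ?_
      rw [invCoeff, neg_mul]; congr 3; push_cast; ring
  rw [h1, ← hFs.tsum_prod, ← Finset.HasAntidiagonal.sigmaAntidiagonalEquivProd.tsum_eq F]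
  rw [Summable.tsum_sigma' (fun l => (hasSum_fintype _).summable) (show Summable fun c => F
    (Finset.HasAntidiagonal.sigmaAntidiagonalEquivProd c) from
    Finset.HasAntidiagonal.sigmaAntidiagonalEquivProd.summable_iff.2 hFs)]
  refine tsum_congr fun l => ?_
  refine (Finset.tsum_subtype (Finset.HasAntidiagonal.antidiagonal l) F).trans ?_
  rw [filtCoeff, Finset.sum_mul]
  refine Finset.sum_congr rfl fun p hp => ?_
  simp only [hF, Finset.HasAntidiagonal.mem_antidiagonal.1 hp]

end InnovationModel

/-! ### Exponential bounds for the filters, uniform in the parameter -/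

lemma exists_succ_mul_pow_le {ρ : ℝ} (h0 : 0 < ρ) (h1 : ρ < 1) :
    ∃ C r : ℝ, 1 ≤ C ∧ ρ ≤ r ∧ r < 1 ∧ ∀ l : ℕ, ((l : ℝ) + 1) * ρ ^ l ≤ C * r ^ l := by
  have hs0 : 0 < √ρ := Real.sqrt_pos.2 h0
  have hs1 : √ρ < 1 := by rw [Real.sqrt_lt' one_pos]; simpa using h1
  have hlim := (tendsto_self_mul_const_pow_of_lt_one hs0.le hs1).add
    (tendsto_pow_atTop_nhds_zero_of_lt_one hs0.le hs1)
  obtain ⟨B, hB⟩ := hlim.bddAbove_range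
  refine ⟨max B 1, √ρ, le_max_right _ _, ?_, hs1, fun l => ?_⟩
  · rw [Real.le_sqrt' h0]; nlinarith
  · have h2 : ρ ^ l = √ρ ^ l * √ρ ^ l := by rw [← mul_pow, Real.mul_self_sqrt h0.le]
    have h3 : (l : ℝ) * √ρ ^ l + √ρ ^ l ≤ B := hB ⟨l, rfl⟩
    rw [h2, ← mul_assoc]
    refine mul_le_mul_of_nonneg_right ?_ (by positivity)
    linarith [le_max_left B 1]

/-- Exponential bounds, with common constants, for the filters in the criterion. -/
structure FilterBounds {Θ : Type*} {d : ℕ} (S : InnovationModel Θ d) (D : Set Θ) (θ' : Θ)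
    (C ρ : ℝ) : Prop where
  const_pos : 0 < C
  rate_pos : 0 < ρ
  rate_lt_one : ρ < 1
  inv : ∀ θ ∈ D, ∀ j, |S.invCoeff θ j| ≤ C * ρ ^ j
  out : ∀ j, |S.outCoeff θ' j| ≤ C * ρ ^ j
  filt : ∀ θ ∈ D, ∀ l, |S.filtCoeff θ θ' l| ≤ C * ρ ^ l
  init : ∀ θ ∈ D, ∀ (k : ℕ) (v : Fin d → ℝ), |∑ i ∈ Finset.range (k + 1),
    S.invCoeff θ i * (S.L θ' ⬝ᵥ (S.H θ' ^ (k - i)).mulVec v)| ≤ C * ρ ^ k * ‖v‖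

lemma continuousOn_invH {E : Type*} [TopologicalSpace E] {d : ℕ} (S : InnovationModel E d)
    {D : Set E} (hH : ContinuousOn S.H D) (hK : ContinuousOn S.K D) (hL : ContinuousOn S.L D) :
    ContinuousOn S.invH D := by
  refine hH.sub (continuousOn_pi.2 fun i => continuousOn_pi.2 fun j => ?_)
  exact ((continuous_apply i).comp_continuousOn hK).mul ((continuous_apply j).comp_continuousOn hL)

lemma exists_filterBounds {E : Type*} [TopologicalSpace E] {d : ℕ} (S : InnovationModel E d)
    {D : Set E} (hD : IsCompact D) (hH : ContinuousOn S.H D) (hK : ContinuousOn S.K D)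
    (hL : ContinuousOn S.L D) {θ' : E} (hθ' : θ' ∈ D)
    (hst : ∀ θ ∈ D, IsStable (S.H θ) ∧ IsStable (S.invH θ)) :
    ∃ C ρ, FilterBounds S D θ' C ρ := by
  have hinvH := continuousOn_invH S hH hK hL
  obtain ⟨C₁, ρ₁, hC₁, hρ₁, hρ₁', h₁⟩ :=
    exists_uniform_norm_mulVec_le hD hinvH (fun θ hθ => (hst θ hθ).2) hL
  obtain ⟨C₂, ρ₂, hC₂, hρ₂, hρ₂', h₂⟩ :=
    exists_uniform_norm_mulVec_le hD hH (fun θ hθ => (hst θ hθ).1) hL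
  obtain ⟨B, hB⟩ := hD.exists_bound_of_continuousOn hK
  set ρ := max ρ₁ ρ₂
  have hρ0 : 0 < ρ := lt_max_of_lt_left hρ₁
  have hρ1 : ρ < 1 := max_lt hρ₁' hρ₂'
  -- Division by `ρ` accounts for the index shift, coefficient `j + 1` carrying the power `j`; the
  -- added `1` covers the leading coefficient.
  set C := (C₁ + C₂) * (|B| + 1) / ρ + 1
  have hC0 : 0 < C := by positivity
  have hC1 : 1 ≤ C := by simp only [C]; linarith [show 0 ≤ (C₁ + C₂) * (|B| + 1) / ρ by positivity]
  have hC12 : C₁ + C₂ ≤ C := by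
    have : C₁ + C₂ ≤ (C₁ + C₂) * (|B| + 1) / ρ := by
      rw [le_div_iff₀ hρ0]
      refine mul_le_mul_of_nonneg_left ?_ (by positivity)
      linarith [abs_nonneg B]
    simp only [C]; linarith
  have hK' : ∀ θ ∈ D, ‖S.K θ‖ ≤ |B| + 1 := fun θ hθ =>
    (hB θ hθ).trans (by linarith [le_abs_self B])
  have step : ∀ (c r : ℝ), 0 ≤ c → 0 ≤ r → c ≤ C₁ + C₂ → r ≤ ρ → ∀ θ ∈ D, ∀ j : ℕ,
      c * r ^ j * ‖S.K θ‖ ≤ C * ρ ^ (j + 1) := by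
    intro c r hc hr hcC hrρ θ hθ j
    calc c * r ^ j * ‖S.K θ‖ ≤ (C₁ + C₂) * ρ ^ j * (|B| + 1) := by
          gcongr
          exact hK' θ hθ
      _ = (C - 1) * ρ ^ (j + 1) := by simp only [C]; field_simp; ring
      _ ≤ C * ρ ^ (j + 1) := by gcongr; linarith
  have hinv : ∀ θ ∈ D, ∀ j, |S.invCoeff θ j| ≤ C * ρ ^ j := by
    intro θ hθ j
    cases j with
    | zero => simpa [InnovationModel.invCoeff] using hC1
    | succ j =>
      rw [InnovationModel.invCoeff, abs_neg]
      exact (h₁ θ hθ j _).trans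
        (step C₁ ρ₁ hC₁.le hρ₁.le (by linarith) (le_max_left _ _) θ hθ j)
  have hout : ∀ j, |S.outCoeff θ' j| ≤ C * ρ ^ j := by
    intro j
    cases j with
    | zero => simpa [InnovationModel.outCoeff] using hC1
    | succ j =>
      rw [InnovationModel.outCoeff]
      exact (h₂ θ' hθ' j _).trans
        (step C₂ ρ₂ hC₂.le hρ₂.le (by linarith) (le_max_right _ _) θ' hθ' j)
  have hinit : ∀ (j : ℕ) (v : Fin d → ℝ),
      |S.L θ' ⬝ᵥ (S.H θ' ^ j).mulVec v| ≤ C * ρ ^ j * ‖v‖ := by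
    intro j v
    refine (h₂ θ' hθ' j v).trans ?_
    gcongr
    · linarith
    · exact le_max_right _ _
  -- A convolution of two sequences of order `ρ ^ l` has `l + 1` terms of that order; the linear
  -- factor is absorbed by the larger rate `r`.
  obtain ⟨A, r, hA, hr, hr1, hAr⟩ := exists_succ_mul_pow_le hρ0 hρ1
  have hle : C ≤ C * C * A := by
    have : 1 ≤ C * A := one_le_mul_of_one_le_of_one_le hC1 hA
    nlinarith
  have hmono : ∀ j : ℕ, C * ρ ^ j ≤ C * C * A * r ^ j := fun j => by gcongr
  refine ⟨C * C * A, r, by positivity, hρ0.trans_le hr, hr1,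
    fun θ hθ j => (hinv θ hθ j).trans (hmono j), fun j => (hout j).trans (hmono j), ?_, ?_⟩
  · intro θ hθ l
    rw [InnovationModel.filtCoeff, Finset.Nat.sum_antidiagonal_eq_sum_range_succ
      (fun i j => S.invCoeff θ i * S.outCoeff θ' j)]
    calc _ ≤ ∑ i ∈ Finset.range (l + 1), |S.invCoeff θ i * S.outCoeff θ' (l - i)| :=
          Finset.abs_sum_le_sum_abs _ _
      _ ≤ ∑ i ∈ Finset.range (l + 1), C * C * ρ ^ l := by
          refine Finset.sum_le_sum fun i hi => ?_
          have hil := Nat.lt_succ_iff.1 (Finset.mem_range.1 hi)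
          rw [abs_mul]
          calc _ ≤ (C * ρ ^ i) * (C * ρ ^ (l - i)) := by
                gcongr
                exacts [hinv θ hθ i, hout _]
            _ = C * C * ρ ^ (i + (l - i)) := by rw [pow_add]; ring
            _ = _ := by rw [Nat.add_sub_cancel' hil]
      _ = C * C * (((l : ℝ) + 1) * ρ ^ l) := by simp; ring
      _ ≤ C * C * (A * r ^ l) := mul_le_mul_of_nonneg_left (hAr l) (by positivity)
      _ = _ := by ring
  · intro θ hθ k v
    calc _ ≤ ∑ i ∈ Finset.range (k + 1),
          |S.invCoeff θ i * (S.L θ' ⬝ᵥ (S.H θ' ^ (k - i)).mulVec v)| :=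
          Finset.abs_sum_le_sum_abs _ _
      _ ≤ ∑ i ∈ Finset.range (k + 1), C * C * ρ ^ k * ‖v‖ := by
          refine Finset.sum_le_sum fun i hi => ?_
          have hil := Nat.lt_succ_iff.1 (Finset.mem_range.1 hi)
          rw [abs_mul]
          calc _ ≤ (C * ρ ^ i) * (C * ρ ^ (k - i) * ‖v‖) := by
                gcongr
                exacts [hinv θ hθ i, hinit _ _]
            _ = C * C * ρ ^ (i + (k - i)) * ‖v‖ := by rw [pow_add]; ring
            _ = _ := by rw [Nat.add_sub_cancel' hil]
      _ = C * C * (((k : ℝ) + 1) * ρ ^ k) * ‖v‖ := by simp; ring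
      _ ≤ C * C * (A * r ^ k) * ‖v‖ := mul_le_mul_of_nonneg_right
          (mul_le_mul_of_nonneg_left (hAr k) (by positivity)) (norm_nonneg v)
      _ = _ := by ring

lemma continuousOn_filtCoeff {E : Type*} [TopologicalSpace E] {d : ℕ} (S : InnovationModel E d)
    {D : Set E} (hH : ContinuousOn S.H D) (hK : ContinuousOn S.K D)
    (hL : ContinuousOn S.L D) (θ' : E) (l : ℕ) :
    ContinuousOn (fun θ => S.filtCoeff θ θ' l) D := by
  have hinvH := continuousOn_invH S hH hK hL
  refine continuousOn_finsetSum _ fun p _ => ContinuousOn.mul ?_ continuousOn_const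
  rcases p with ⟨i, j⟩
  cases i with
  | zero => exact continuousOn_const
  | succ i =>
    refine ContinuousOn.neg ?_
    have hpow : ContinuousOn (fun θ => S.invH θ ^ i) D := hinvH.pow i
    have : Continuous fun q : (Fin d → ℝ) × Matrix (Fin d) (Fin d) ℝ × (Fin d → ℝ) =>
        q.1 ⬝ᵥ q.2.1.mulVec q.2.2 := by fun_prop
    exact this.comp_continuousOn (hL.prodMk (hpow.prodMk hK))

/-! ### The noise: independence and integrability of the Lévy increments -/

section Levy

variable {Ω : Type*} [MeasurableSpace Ω] {P : Measure Ω} {Z : ℝ → Ω → ℝ} {b : ℝ} {ν : Measure ℝ}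

lemma IsLevyProcess.measurable_increment (hZ : IsLevyProcess P Z b ν) (h : ℝ) (n : ℤ) :
    Measurable (increment Z h n) := (hZ.measurable _).sub (hZ.measurable _)

lemma IsLevyProcess.iIndepFun_increment [IsProbabilityMeasure P] (hZ : IsLevyProcess P Z b ν)
    {h : ℝ} (hh : 0 ≤ h) : iIndepFun (fun n : ℤ => increment Z h n) P := by
  refine iIndepFun_iff_finset.2 fun s => ?_
  obtain rfl | hs := s.eq_empty_or_nonempty
  · exact iIndepFun.of_subsingleton
  · set m := s.min' hs
    -- Independence of increments is available along monotone time sequences indexed by `ℕ`; the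
    -- grid therefore starts at the left end of the earliest increment in the finite set.
    have hmono : Monotone fun k : ℕ => ((m : ℝ) - 1 + k) * h := fun i j hij => by
      have : (i : ℝ) ≤ j := by exact_mod_cast hij
      exact mul_le_mul_of_nonneg_right (by linarith) hh
    let g (x : s) : ℕ := (x.1 - m).toNat
    have hg : ∀ x : s, ((g x : ℤ) : ℝ) = (x.1 : ℝ) - m := fun x => by
      have := s.min'_le x.1 x.2
      rw [Int.toNat_of_nonneg (by omega)]; push_cast; ring
    have hinj : Function.Injective g := fun x y hxy => by
      have h1 := hg x
      rw [hxy, hg y] at h1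
      exact Subtype.ext (by exact_mod_cast (by linarith : (x.1 : ℝ) = y.1))
    have := (hZ.indep.nat hmono).precomp hinj
    convert this using 2 with x
    funext ω
    have := hg x
    simp only [Int.cast_natCast] at this
    simp only [Finset.restrict, increment, Nat.cast_add, Nat.cast_one, this]
    congr 2 <;> ring

lemma IsLevyProcess.integral_exp_increment (hZ : IsLevyProcess P Z b ν) {h : ℝ} (hh : 0 ≤ h)
    (n : ℤ) (u : ℝ) :
    ∫ ω, Complex.exp (Complex.I * u * (increment Z h n ω : ℂ)) ∂P =
      Complex.exp (h * charExponent b ν u) := by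
  have := hZ.charFun ((n - 1) * h) (n * h) (by nlinarith) u
  rw [show n * h - (n - 1) * h = h by ring] at this
  exact this

lemma norm_exp_I_mul_sub_one_le (x : ℝ) : ‖Complex.exp (Complex.I * x) - 1‖ ≤ |x| := by
  rw [Complex.norm_exp_I_mul_ofReal_sub_one, norm_mul, Real.norm_two, Real.norm_eq_abs]
  have := Real.abs_sin_le_abs (x := x / 2)
  rw [abs_div, abs_two] at this
  linarith

lemma IsLevyMeasure.integrable_id (hν : IsLevyMeasure ν)
    (hmom : ∫⁻ x in {x : ℝ | 1 ≤ |x|}, ENNReal.ofReal (|x| ^ (2 : ℝ)) ∂ν < ⊤) :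
    Integrable (fun x : ℝ => x) ν ∧ Integrable (fun x : ℝ => x ^ 2) ν := by
  have key : ∫⁻ x, ENNReal.ofReal (min |x| 1) +
      {x : ℝ | 1 ≤ |x|}.indicator (fun x => ENNReal.ofReal (|x| ^ (2 : ℝ))) x ∂ν < ⊤ := by
    rw [lintegral_add_left (by fun_prop),
      lintegral_indicator (measurableSet_le (by fun_prop) (by fun_prop))]
    exact ENNReal.add_lt_top.2 ⟨hν.integrable, hmom⟩
  constructor
  · refine ⟨by fun_prop, (lintegral_mono fun x => ?_).trans_lt key⟩
    rw [Real.enorm_eq_ofReal_abs]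
    rcases lt_or_ge |x| 1 with hx | hx
    · rw [min_eq_left hx.le]; exact le_self_add
    · rw [Set.indicator_of_mem (by exact hx)]
      refine le_add_left (ENNReal.ofReal_le_ofReal ?_)
      rw [Real.rpow_two]; nlinarith
  · refine ⟨by fun_prop, (lintegral_mono fun x => ?_).trans_lt key⟩
    rw [Real.enorm_eq_ofReal_abs, abs_pow]
    rcases lt_or_ge |x| 1 with hx | hx
    · rw [min_eq_left hx.le]
      refine le_add_right (ENNReal.ofReal_le_ofReal ?_)
      nlinarith [abs_nonneg x]
    · rw [Set.indicator_of_mem (by exact hx)]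
      refine le_add_left (ENNReal.ofReal_le_ofReal ?_)
      rw [Real.rpow_two]

lemma one_sub_cos_le (x : ℝ) : 1 - Real.cos x ≤ x ^ 2 / 2 := by
  linarith [Real.one_sub_sq_div_two_le_cos (x := x)]

lemma norm_charExponent_le (hν : Integrable (fun x : ℝ => x) ν) (u : ℝ) :
    ‖charExponent b ν u‖ ≤ (|b| + ∫ x, |x| ∂ν) * |u| := by
  rw [charExponent, add_mul]
  refine (norm_add_le _ _).trans (add_le_add ?_ ?_)
  · simp
  · refine (norm_integral_le_of_norm_le (g := fun x => |x| * |u|) (hν.abs.mul_const _)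
      (Eventually.of_forall fun x => ?_)).trans_eq (integral_mul_const _ _)
    have := norm_exp_I_mul_sub_one_le (u * x)
    rw [abs_mul, mul_comm |u|] at this
    simpa [mul_assoc] using this

lemma neg_le_re_charExponent (hν : Integrable (fun x : ℝ => x) ν)
    (hν2 : Integrable (fun x : ℝ => x ^ 2) ν) (u : ℝ) :
    -(u ^ 2 / 2 * ∫ x, x ^ 2 ∂ν) ≤ (charExponent b ν u).re := by
  have hint : Integrable (fun x : ℝ => Complex.exp (Complex.I * u * x) - 1) ν := by
    refine (hν.abs.mul_const |u|).mono' (by fun_prop) (Eventually.of_forall fun x => ?_)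
    have := norm_exp_I_mul_sub_one_le (u * x)
    rw [abs_mul, mul_comm |u|] at this
    simpa [mul_assoc] using this
  have hre : (charExponent b ν u).re = ∫ x : ℝ, (Real.cos (u * x) - 1) ∂ν := by
    have hri : (∫ x : ℝ, (Complex.exp (Complex.I * u * x) - 1) ∂ν).re =
        ∫ x : ℝ, RCLike.re (Complex.exp (Complex.I * u * x) - 1) ∂ν := (integral_re hint).symm
    rw [charExponent, Complex.add_re, hri]
    have : ∀ x : ℝ, RCLike.re (Complex.exp (Complex.I * u * x) - 1) = Real.cos (u * x) - 1 := by
      intro x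
      rw [RCLike.re_eq_complex_re, Complex.sub_re, Complex.one_re,
        show Complex.I * u * x = ((u * x : ℝ) : ℂ) * Complex.I by push_cast; ring,
        Complex.exp_ofReal_mul_I_re]
    simp_rw [this]
    simp
  rw [hre, ← integral_const_mul, ← integral_neg]
  refine integral_mono (hν2.const_mul _).neg ?_ fun x => ?_
  · refine (hν2.const_mul (u ^ 2 / 2)).mono' (by fun_prop) (Eventually.of_forall fun x => ?_)
    rw [Real.norm_eq_abs, abs_le]
    have := one_sub_cos_le (u * x)
    have := Real.cos_le_one (u * x)
    constructor <;> nlinarith [sq_nonneg (u * x)]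
  · have := one_sub_cos_le (u * x)
    simp only
    nlinarith

/-- With `w = h ψ(u)`, `Re e^w ≥ 1 + Re w - |w|²` for small `w`. The exponent itself is only
`O(|u|)`, because of the drift, but its real part is bounded below by `-O(u²)`. -/
lemma exists_one_sub_re_exp_charExponent_le (hν : Integrable (fun x : ℝ => x) ν)
    (hν2 : Integrable (fun x : ℝ => x ^ 2) ν) {h : ℝ} (hh : 0 ≤ h) :
    ∃ C, ∀ᶠ u : ℝ in 𝓝 0, 1 - (Complex.exp (h * charExponent b ν u)).re ≤ C * u ^ 2 := by
  set A := h * (|b| + ∫ x, |x| ∂ν)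
  have hA : 0 ≤ A :=
    mul_nonneg hh (add_nonneg (abs_nonneg _) (integral_nonneg fun _ => abs_nonneg _))
  refine ⟨h / 2 * ∫ x, x ^ 2 ∂ν + A ^ 2, ?_⟩
  have hev : ∀ᶠ u : ℝ in 𝓝 0, A * |u| < 1 := by
    have : Tendsto (fun u : ℝ => A * |u|) (𝓝 0) (𝓝 (A * |0|)) :=
      (continuous_const.mul continuous_abs).tendsto 0
    exact this.eventually_lt_const (by simp)
  filter_upwards [hev] with u hu
  set w : ℂ := h * charExponent b ν u
  have hw : ‖w‖ ≤ A * |u| := by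
    simp only [w, A]
    rw [norm_mul, Complex.norm_real, Real.norm_of_nonneg hh, mul_assoc]
    exact mul_le_mul_of_nonneg_left (norm_charExponent_le hν u) hh
  have h1 := Complex.norm_exp_sub_one_sub_id_le (hw.trans hu.le)
  have h2 : -(Complex.exp w - 1 - w).re ≤ ‖w‖ ^ 2 := by
    have := Complex.abs_re_le_norm (Complex.exp w - 1 - w)
    linarith [neg_le_abs (Complex.exp w - 1 - w).re]
  have h3 : -(h * (u ^ 2 / 2 * ∫ x, x ^ 2 ∂ν)) ≤ w.re := by
    have := mul_le_mul_of_nonneg_left (neg_le_re_charExponent (b := b) hν hν2 u) hh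
    simp only [w, Complex.re_ofReal_mul]
    linarith
  have h4 : ‖w‖ ^ 2 ≤ A ^ 2 * u ^ 2 := by
    have := pow_le_pow_left₀ (norm_nonneg _) hw 2
    rwa [mul_pow, sq_abs] at this
  simp only [Complex.sub_re, Complex.one_re] at h2
  nlinarith

/-- A law whose characteristic function satisfies `1 - Re φ(u) = O(u²)` at `0` has a finite
second moment. -/
lemma integrable_sq_of_one_sub_re_charFun_le [IsProbabilityMeasure P] {X : Ω → ℝ}
    (hX : Measurable X) {C : ℝ}
    (hC : ∀ᶠ u : ℝ in 𝓝 0, 1 - (∫ ω, Complex.exp (Complex.I * u * (X ω : ℂ)) ∂P).re ≤ C * u ^ 2) :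
    Integrable (fun ω => X ω ^ 2) P := by
  have hcos : ∀ u : ℝ, (∫ ω, Complex.exp (Complex.I * u * (X ω : ℂ)) ∂P).re =
      ∫ ω, Real.cos (u * X ω) ∂P := by
    intro u
    have hint : Integrable (fun ω => Complex.exp (Complex.I * u * (X ω : ℂ))) P := by
      refine Integrable.of_bound (C := 1) (by fun_prop) (Eventually.of_forall fun ω => ?_)
      rw [show Complex.I * u * (X ω : ℂ) = ((u * X ω : ℝ) : ℂ) * Complex.I by push_cast; ring,
        Complex.norm_exp_ofReal_mul_I]
    rw [← RCLike.re_eq_complex_re, ← integral_re hint]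
    refine integral_congr_ae (Eventually.of_forall fun ω => ?_)
    simp only
    rw [RCLike.re_eq_complex_re,
      show Complex.I * u * (X ω : ℂ) = ((u * X ω : ℝ) : ℂ) * Complex.I by push_cast; ring,
      Complex.exp_ofReal_mul_I_re]
  have hcosint : ∀ u : ℝ, Integrable (fun ω => Real.cos (u * X ω)) P := fun u =>
    Integrable.of_bound (C := 1) (by fun_prop)
      (Eventually.of_forall fun ω => Real.abs_cos_le_one _)
  have hseq : Tendsto (fun n : ℕ => 1 / ((n : ℝ) + 1)) atTop (𝓝 0) :=
    tendsto_one_div_add_atTop_nhds_zero_nat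
  set v : ℕ → ℝ := fun n => 1 / ((n : ℝ) + 1)
  have hv : ∀ n, 0 < v n := fun n => by positivity
  -- Fatou's lemma is applied to `2 (1 - cos (vX)) / v²`, which is nonnegative, tends to `X²` as `v
  -- → 0`, and has bounded expectation by hypothesis.
  set F : ℕ → Ω → ENNReal := fun n ω =>
    ENNReal.ofReal (2 / v n ^ 2 * (1 - Real.cos (v n * X ω)))
  have hFlim : ∀ ω, Tendsto (fun n => F n ω) atTop (𝓝 (ENNReal.ofReal (X ω ^ 2))) := by
    intro ω
    refine ENNReal.tendsto_ofReal ?_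
    have hid : ∀ n, 2 / v n ^ 2 * (1 - Real.cos (v n * X ω)) =
        (X ω * Real.sinc (v n * X ω / 2)) ^ 2 := by
      intro n
      have hcs : 1 - Real.cos (v n * X ω) = 2 * Real.sin (v n * X ω / 2) ^ 2 := by
        have := Real.cos_sq (v n * X ω / 2)
        have h2 := Real.sin_sq_add_cos_sq (v n * X ω / 2)
        rw [show 2 * (v n * X ω / 2) = v n * X ω by ring] at this
        linarith
      rw [hcs]
      rcases eq_or_ne (X ω) 0 with h0 | h0
      · simp [h0]
      · have := (hv n).ne'
        rw [Real.sinc_of_ne_zero (by positivity)]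
        field_simp
    simp_rw [hid]
    have hs : Tendsto (fun n => Real.sinc (v n * X ω / 2)) atTop (𝓝 (Real.sinc (0 * X ω / 2))) :=
      (Real.continuous_sinc.tendsto _).comp ((hseq.mul_const _).div_const _)
    have := (hs.const_mul (X ω)).pow 2
    simpa using this
  have hbound : ∀ᶠ n in atTop, ∫⁻ ω, F n ω ∂P ≤ ENNReal.ofReal (2 * C) := by
    filter_upwards [hseq.eventually hC] with n hn
    have hint : Integrable (fun ω => 2 / v n ^ 2 * (1 - Real.cos (v n * X ω))) P :=
      ((integrable_const 1).sub (hcosint _)).const_mul _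
    rw [← ofReal_integral_eq_lintegral_ofReal hint (Eventually.of_forall fun ω =>
      mul_nonneg (div_nonneg zero_le_two (sq_nonneg _)) (sub_nonneg.2 (Real.cos_le_one _)))]
    refine ENNReal.ofReal_le_ofReal ?_
    rw [integral_const_mul, integral_sub (integrable_const 1) (hcosint _)]
    simp only [integral_const, probReal_univ, smul_eq_mul, mul_one]
    rw [hcos] at hn
    have hv2 : 0 < v n ^ 2 := pow_pos (hv n) 2
    rw [div_mul_eq_mul_div, div_le_iff₀ hv2]
    linarith
  refine ⟨by fun_prop, ?_⟩
  have hfatou : ∫⁻ ω, ‖X ω ^ 2‖ₑ ∂P ≤ ENNReal.ofReal (2 * C) := by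
    calc ∫⁻ ω, ‖X ω ^ 2‖ₑ ∂P = ∫⁻ ω, liminf (fun n => F n ω) atTop ∂P := by
          refine lintegral_congr fun ω => ?_
          rw [(hFlim ω).liminf_eq, Real.enorm_of_nonneg (sq_nonneg _)]
      _ ≤ liminf (fun n => ∫⁻ ω, F n ω ∂P) atTop :=
          lintegral_liminf_le fun n => by fun_prop
      _ ≤ ENNReal.ofReal (2 * C) := by
          refine liminf_le_of_frequently_le' hbound.frequently
  exact hfatou.trans_lt ENNReal.ofReal_lt_top

lemma IsLevyProcess.integrable_increment [IsProbabilityMeasure P] (hZ : IsLevyProcess P Z b ν)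
    (hν : IsLevyMeasure ν)
    (hmom : ∫⁻ x in {x : ℝ | 1 ≤ |x|}, ENNReal.ofReal (|x| ^ (2 : ℝ)) ∂ν < ⊤)
    {h : ℝ} (hh : 0 ≤ h) (n : ℤ) : Integrable (increment Z h n) P := by
  obtain ⟨h1, h2⟩ := hν.integrable_id hmom
  obtain ⟨C, hC⟩ := exists_one_sub_re_exp_charExponent_le (b := b) h1 h2 hh
  have hm := hZ.measurable_increment h n
  have hsq : Integrable (fun ω => increment Z h n ω ^ 2) P :=
    integrable_sq_of_one_sub_re_charFun_le hm (C := C) (by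
      simpa only [hZ.integral_exp_increment hh n] using hC)
  refine ((memLp_two_iff_integrable_sq hm.aestronglyMeasurable).2 hsq).integrable (by norm_num)

lemma IsLevyProcess.integral_abs_increment [IsProbabilityMeasure P] (hZ : IsLevyProcess P Z b ν)
    {h : ℝ} (hh : 0 ≤ h) (n : ℤ) :
    ∫ ω, |increment Z h n ω| ∂P = ∫ ω, |increment Z h 0 ω| ∂P := by
  have hm := hZ.measurable_increment h
  have hprob : ∀ n, IsProbabilityMeasure (P.map (increment Z h n)) := fun n =>
    Measure.isProbabilityMeasure_map (hm n).aemeasurable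
  have hlaw : P.map (increment Z h n) = P.map (increment Z h 0) := by
    refine Measure.ext_of_charFun ?_
    funext t
    have : ∀ n, MeasureTheory.charFun (P.map (increment Z h n)) t =
        Complex.exp (h * charExponent b ν t) := by
      intro n
      rw [charFun_apply_real, integral_map (hm n).aemeasurable (by fun_prop),
        ← hZ.integral_exp_increment hh n t]
      refine integral_congr_ae (Eventually.of_forall fun ω => ?_)
      simp only; congr 1; ring
    rw [this, this]
  have : ∀ n, ∫ ω, |increment Z h n ω| ∂P = ∫ x, |x| ∂(P.map (increment Z h n)) := fun n =>
    (integral_map (hm n).aemeasurable (by fun_prop)).symm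
  rw [this, this, hlaw]

end Levy

/-! ### Even moments of sums of bounded centred variables -/

lemma abs_pow_mul_abs_pow_le (s x : ℝ) {q m : ℕ} (hm : m ≤ 2 * q) :
    |x| ^ m * |s| ^ (2 * q - m) ≤ s ^ (2 * q) + x ^ (2 * q) := by
  have h1 : s ^ (2 * q) = |s| ^ (2 * q) := (Even.pow_abs (even_two_mul q) s).symm
  have h2 : x ^ (2 * q) = |x| ^ (2 * q) := (Even.pow_abs (even_two_mul q) x).symm
  rw [h1, h2]
  rcases le_total |x| |s| with h | h
  · calc |x| ^ m * |s| ^ (2 * q - m) ≤ |s| ^ m * |s| ^ (2 * q - m) := by gcongr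
      _ = |s| ^ (2 * q) := by rw [← pow_add, Nat.add_sub_cancel' hm]
      _ ≤ _ := le_add_of_nonneg_right (by positivity)
  · calc |x| ^ m * |s| ^ (2 * q - m) ≤ |x| ^ m * |x| ^ (2 * q - m) := by gcongr
      _ = |x| ^ (2 * q) := by rw [← pow_add, Nat.add_sub_cancel' hm]
      _ ≤ _ := le_add_of_nonneg_left (by positivity)

/-- In the binomial expansion the term linear in `x` is kept exactly, since it will have zero mean;
every further term contains `x ^ 2` and is estimated crudely. -/
lemma add_pow_two_mul_succ_le (s x : ℝ) (q : ℕ) :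
    (s + x) ^ (2 * q + 2) ≤ s ^ (2 * q + 2) + (2 * q + 2) * (s ^ (2 * q + 1) * x) +
      2 ^ (2 * q + 2) * (s ^ (2 * q) * x ^ 2 + x ^ (2 * q + 2)) := by
  have hrest : ∑ m ∈ Finset.range (2 * q + 1),
      x ^ (m + 2) * s ^ (2 * q + 2 - (m + 2)) * ((2 * q + 2).choose (m + 2)) ≤
      2 ^ (2 * q + 2) * (s ^ (2 * q) * x ^ 2 + x ^ (2 * q + 2)) := by
    have hterm : ∀ m ∈ Finset.range (2 * q + 1),
        x ^ (m + 2) * s ^ (2 * q + 2 - (m + 2)) * ((2 * q + 2).choose (m + 2)) ≤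
        (s ^ (2 * q) * x ^ 2 + x ^ (2 * q + 2)) * ((2 * q + 2).choose (m + 2)) := by
      intro m hm
      refine mul_le_mul_of_nonneg_right ?_ (Nat.cast_nonneg _)
      have hm' : m ≤ 2 * q := Nat.lt_succ_iff.1 (Finset.mem_range.1 hm)
      rw [show 2 * q + 2 - (m + 2) = 2 * q - m by omega]
      calc x ^ (m + 2) * s ^ (2 * q - m) ≤ |x ^ (m + 2) * s ^ (2 * q - m)| := le_abs_self _
        _ = x ^ 2 * (|x| ^ m * |s| ^ (2 * q - m)) := by
            rw [abs_mul, abs_pow, abs_pow, pow_add, sq_abs]; ring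
        _ ≤ x ^ 2 * (s ^ (2 * q) + x ^ (2 * q)) :=
            mul_le_mul_of_nonneg_left (abs_pow_mul_abs_pow_le s x hm') (sq_nonneg _)
        _ = _ := by ring
    refine (Finset.sum_le_sum hterm).trans ?_
    rw [← Finset.mul_sum, mul_comm]
    refine mul_le_mul_of_nonneg_right ?_ (add_nonneg (mul_nonneg
      (Even.pow_nonneg (even_two_mul q) s) (sq_nonneg x))
      (Even.pow_nonneg ⟨q + 1, by ring⟩ x))
    have h := Nat.sum_range_choose (2 * q + 2)
    rw [show 2 * q + 2 + 1 = (2 * q + 1) + 1 + 1 by ring, Finset.sum_range_succ',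
      Finset.sum_range_succ'] at h
    have h' : ∑ m ∈ Finset.range (2 * q + 1), (2 * q + 2).choose (m + 2) ≤ 2 ^ (2 * q + 2) := by
      have h'' : ∑ m ∈ Finset.range (2 * q + 1), (2 * q + 2).choose (m + 1 + 1) ≤
        2 ^ (2 * q + 2) := by omega
      exact h''
    exact_mod_cast h'
  have hexp := add_pow x s (2 * q + 2)
  rw [show 2 * q + 2 + 1 = (2 * q + 1) + 1 + 1 by ring, Finset.sum_range_succ',
    Finset.sum_range_succ'] at hexp
  rw [add_comm s x, hexp]
  have h1 : x ^ (0 + 1) * s ^ (2 * q + 2 - (0 + 1)) * ((2 * q + 2).choose (0 + 1) : ℝ) =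
      (2 * q + 2) * (s ^ (2 * q + 1) * x) := by
    rw [show 2 * q + 2 - (0 + 1) = 2 * q + 1 by omega]
    simp; ring
  have h2 : x ^ 0 * s ^ (2 * q + 2 - 0) * ((2 * q + 2).choose 0 : ℝ) = s ^ (2 * q + 2) := by simp
  rw [h1, h2]
  linarith [hrest]

section Moments

variable {Ω : Type*} [MeasurableSpace Ω] {P : Measure Ω} [IsProbabilityMeasure P]

/-- Independence and centring remove the linear term, and `|X| ≤ 1` turns every higher moment of `X`
into its second moment, so the growth is linear in the variance. -/
lemma integral_add_pow_le {S X : Ω → ℝ} (hS : Measurable S) (hX : Measurable X)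
    (hSX : IndepFun S X P) {B : ℝ} (hSB : ∀ ω, |S ω| ≤ B) (hX1 : ∀ ω, |X ω| ≤ 1)
    (hX0 : ∫ ω, X ω ∂P = 0) (q : ℕ) :
    ∫ ω, (S ω + X ω) ^ (2 * q + 2) ∂P ≤ ∫ ω, S ω ^ (2 * q + 2) ∂P +
      2 ^ (2 * q + 2) * ((∫ ω, S ω ^ (2 * q) ∂P) + 1) * ∫ ω, X ω ^ 2 ∂P := by
  have hSn : ∀ n : ℕ, Integrable (fun ω => S ω ^ n) P := fun n =>
    Integrable.of_bound (C := B ^ n) (by fun_prop) (Eventually.of_forall fun ω => by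
      rw [Real.norm_eq_abs, abs_pow]; exact pow_le_pow_left₀ (abs_nonneg _) (hSB ω) n)
  have hXn : ∀ n : ℕ, Integrable (fun ω => X ω ^ n) P := fun n =>
    Integrable.of_bound (C := 1 ^ n) (by fun_prop) (Eventually.of_forall fun ω => by
      rw [Real.norm_eq_abs, abs_pow]; exact pow_le_pow_left₀ (abs_nonneg _) (hX1 ω) n)
  have hind : ∀ m n : ℕ, IndepFun (fun ω => S ω ^ m) (fun ω => X ω ^ n) P := fun m n =>
    hSX.comp (φ := fun x => x ^ m) (ψ := fun x => x ^ n) (by fun_prop) (by fun_prop)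
  have hprod : ∀ m n : ℕ, Integrable (fun ω => S ω ^ m * X ω ^ n) P := fun m n =>
    (hind m n).integrable_mul (hSn m) (hXn n)
  have hmul : ∀ m n : ℕ, ∫ ω, S ω ^ m * X ω ^ n ∂P = (∫ ω, S ω ^ m ∂P) * ∫ ω, X ω ^ n ∂P :=
    fun m n => (hind m n).integral_fun_mul_eq_mul_integral
      (hSn m).aestronglyMeasurable (hXn n).aestronglyMeasurable
  have h1 := integral_mono_of_nonneg (μ := P)
    (Eventually.of_forall fun ω =>
      Even.pow_nonneg (⟨q + 1, by ring⟩ : Even (2 * q + 2)) (S ω + X ω))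
    ((((hSn (2 * q + 2)).add (((hprod (2 * q + 1) 1)).const_mul (2 * (q : ℝ) + 2))).add
      (((hprod (2 * q) 2).add (hXn (2 * q + 2))).const_mul (2 ^ (2 * q + 2)))))
    (Eventually.of_forall fun ω => by
      simpa using add_pow_two_mul_succ_le (S ω) (X ω) q)
  refine h1.trans ?_
  simp only [Pi.add_apply]
  rw [integral_add (by exact (hSn _).add ((hprod _ 1).const_mul _))
      (by exact ((hprod _ 2).add (hXn _)).const_mul _),
    integral_add (hSn _) ((hprod _ 1).const_mul _), integral_const_mul, integral_const_mul,
    integral_add (hprod _ 2) (hXn _), hmul, hmul]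
  simp only [pow_one, hX0, mul_zero, add_zero]
  have h2 : ∫ ω, X ω ^ (2 * q + 2) ∂P ≤ ∫ ω, X ω ^ 2 ∂P := by
    refine integral_mono (hXn _) (hXn _) fun ω => ?_
    simp only
    rw [← sq_abs, ← Even.pow_abs (⟨q + 1, by ring⟩ : Even (2 * q + 2)) (X ω)]
    exact pow_le_pow_of_le_one (abs_nonneg _) (hX1 ω) (by omega)
  have h3 : (0 : ℝ) < 2 ^ (2 * q + 2) := by positivity
  nlinarith

/-- Moments of even order of sums of bounded centred variables, each independent of the sum of its
predecessors. -/
lemma exists_integral_sum_pow_le (q : ℕ) : ∃ C : ℝ, 0 ≤ C ∧ ∀ (X : ℕ → Ω → ℝ) (κ : ℝ),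
    (∀ i, Measurable (X i)) → (∀ i ω, |X i ω| ≤ 1) → (∀ i, ∫ ω, X i ω ∂P = 0) →
    (∀ i, ∫ ω, X i ω ^ 2 ∂P ≤ κ) →
    (∀ n, IndepFun (fun ω => ∑ i ∈ Finset.range n, X i ω) (X n) P) →
    ∀ n : ℕ, ∫ ω, (∑ i ∈ Finset.range n, X i ω) ^ (2 * q + 2) ∂P ≤ C * (n : ℝ) ^ (q + 1) * κ := by
  -- Induction on the order of the moment: growth `n ^ q` of the moment of order `2 * q` is summed
  -- over `n` to growth `n ^ (q + 1)` of the next one. Each passage produces one factor `κ`.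
  have step : ∀ (q : ℕ) (A : ℝ), 0 ≤ A → ∀ (X : ℕ → Ω → ℝ) (κ : ℝ),
      (∀ i, Measurable (X i)) → (∀ i ω, |X i ω| ≤ 1) → (∀ i, ∫ ω, X i ω ∂P = 0) →
      (∀ i, ∫ ω, X i ω ^ 2 ∂P ≤ κ) →
      (∀ n, IndepFun (fun ω => ∑ i ∈ Finset.range n, X i ω) (X n) P) →
      (∀ n : ℕ, ∫ ω, (∑ i ∈ Finset.range n, X i ω) ^ (2 * q) ∂P ≤ A * (n : ℝ) ^ q) →
      ∀ n : ℕ, ∫ ω, (∑ i ∈ Finset.range n, X i ω) ^ (2 * q + 2) ∂P ≤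
        2 ^ (2 * q + 2) * (A + 1) * (n : ℝ) ^ (q + 1) * κ := by
    intro q A hA X κ hm h1 h0 h2 hind hq n
    have hκ : 0 ≤ κ := (integral_nonneg fun ω => sq_nonneg _).trans (h2 0)
    induction n with
    | zero => simp
    | succ n ih =>
      simp_rw [Finset.sum_range_succ]
      have hb : ∀ ω, |∑ i ∈ Finset.range n, X i ω| ≤ n := fun ω =>
        (Finset.abs_sum_le_sum_abs _ _).trans
          ((Finset.sum_le_sum fun i _ => h1 i ω).trans (by simp))
      have hs := integral_add_pow_le (P := P) (S := fun ω => ∑ i ∈ Finset.range n, X i ω)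
        (by fun_prop) (hm n) (hind n) hb (h1 n) (h0 n) q
      refine hs.trans ?_
      have e1 : ((∫ ω, (∑ i ∈ Finset.range n, X i ω) ^ (2 * q) ∂P) + 1) * ∫ ω, X n ω ^ 2 ∂P ≤
          (A + 1) * ((n : ℝ) + 1) ^ q * κ := by
        refine mul_le_mul ?_ (h2 n) (integral_nonneg fun ω => sq_nonneg _) (by positivity)
        have e2 : (n : ℝ) ^ q ≤ ((n : ℝ) + 1) ^ q := by gcongr; linarith
        have e3 : (1 : ℝ) ≤ ((n : ℝ) + 1) ^ q := one_le_pow₀ (by linarith [n.cast_nonneg (α := ℝ)])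
        have := hq n
        nlinarith
      have e4 : (n : ℝ) ^ (q + 1) ≤ (n : ℝ) * ((n : ℝ) + 1) ^ q := by
        rw [pow_succ']
        gcongr; linarith
      calc _ ≤ 2 ^ (2 * q + 2) * (A + 1) * (n : ℝ) ^ (q + 1) * κ +
            2 ^ (2 * q + 2) * ((A + 1) * ((n : ℝ) + 1) ^ q * κ) := by
            refine add_le_add ih ?_
            rw [mul_assoc]
            gcongr
        _ ≤ 2 ^ (2 * q + 2) * (A + 1) * ((n : ℝ) * ((n : ℝ) + 1) ^ q) * κ +
            2 ^ (2 * q + 2) * ((A + 1) * ((n : ℝ) + 1) ^ q * κ) := by gcongr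
        _ = _ := by push_cast; ring
  induction q with
  | zero =>
    refine ⟨2 ^ (2 * 0 + 2) * (1 + 1), by norm_num, fun X κ hm h1 h0 h2 hind n => ?_⟩
    exact step 0 1 zero_le_one X κ hm h1 h0 h2 hind (fun n => by simp) n
  | succ q ih =>
    obtain ⟨A, hA, hAX⟩ := ih
    refine ⟨2 ^ (2 * (q + 1) + 2) * (A + 1), by positivity, fun X κ hm h1 h0 h2 hind n => ?_⟩
    refine step (q + 1) A hA X κ hm h1 h0 h2 hind (fun n => ?_) n
    -- The lower moment is taken with variance bound `1`, so that the final estimate is linear in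
    -- `κ`.
    have h2' : ∀ i, ∫ ω, X i ω ^ 2 ∂P ≤ 1 := fun i => by
      have : ∫ ω, X i ω ^ 2 ∂P ≤ ∫ _, (1 : ℝ) ∂P :=
        integral_mono_of_nonneg (Eventually.of_forall fun ω => sq_nonneg _) (integrable_const _)
          (Eventually.of_forall fun ω => (sq_le_one_iff_abs_le_one _).2 (h1 i ω))
      simpa using this
    have := hAX X 1 hm h1 h0 h2' hind n
    rwa [mul_one] at this

end Moments

/-! ### Truncated moving averages: telescoping in the truncation length -/

lemma eLpNorm_le_of_integral_pow_le {Ω E : Type*} [MeasurableSpace Ω] {P : Measure Ω}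
    [NormedAddCommGroup E] {Y : Ω → E} {n : ℕ} (hn : n ≠ 0) {R : ℝ} (hR : 0 ≤ R)
    (hint : Integrable (fun ω => ‖Y ω‖ ^ n) P) (h : ∫ ω, ‖Y ω‖ ^ n ∂P ≤ R ^ n) :
    eLpNorm Y n P ≤ ENNReal.ofReal R := by
  rw [eLpNorm_eq_lintegral_rpow_enorm_toReal (by simpa using hn) (by simp)]
  have h1 : ∫⁻ ω, ‖Y ω‖ₑ ^ (ENNReal.toReal n) ∂P = ENNReal.ofReal (∫ ω, ‖Y ω‖ ^ n ∂P) := by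
    rw [ofReal_integral_eq_lintegral_ofReal hint (Eventually.of_forall fun ω => by positivity)]
    refine lintegral_congr fun ω => ?_
    rw [ENNReal.toReal_natCast, ENNReal.rpow_natCast, ENNReal.ofReal_pow (norm_nonneg _),
      ofReal_norm]
  rw [h1]
  calc _ ≤ (ENNReal.ofReal (R ^ n)) ^ (1 / ENNReal.toReal n) :=
        ENNReal.rpow_le_rpow (ENNReal.ofReal_le_ofReal h) (by positivity)
    _ = ENNReal.ofReal R := by
        rw [ENNReal.ofReal_pow hR, ← ENNReal.rpow_natCast, ← ENNReal.rpow_mul,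
          ENNReal.toReal_natCast, mul_one_div_cancel (by exact_mod_cast hn), ENNReal.rpow_one]

/-- Output at time `k + 1` of the moving average with coefficients `c`, truncated after `J`
terms. -/
def filtSum {Ω : Type*} (c : ℕ → ℝ) (e : ℤ → Ω → ℝ) (k J : ℕ) (ω : Ω) : ℝ :=
  ∑ l ∈ Finset.range J, c l * e ((k : ℤ) + 1 - l) ω

lemma measurable_filtSum {Ω : Type*} [MeasurableSpace Ω] (c : ℕ → ℝ) {e : ℤ → Ω → ℝ} (k J : ℕ)
    (he : ∀ l < J, Measurable (e ((k : ℤ) + 1 - l))) : Measurable (filtSum c e k J) :=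
  Finset.measurable_fun_sum _ fun l hl => (he l (Finset.mem_range.1 hl)).const_mul _

lemma filtSum_succ {Ω : Type*} (c : ℕ → ℝ) (e : ℤ → Ω → ℝ) (k J : ℕ) (ω : Ω) :
    filtSum c e k (J + 1) ω = filtSum c e k J ω + c J * e ((k : ℤ) + 1 - J) ω :=
  Finset.sum_range_succ _ _

/-- Increment `f(T_{k,j+1}) - f(T_{k,j})` of the truncated outputs, scaled, recentred by `a k` and
restricted to times congruent to `r` modulo `j + 1`. -/
noncomputable def maskedDiff {Ω : Type*} (f : ℝ → ℝ) (c : ℕ → ℝ) (e : ℤ → Ω → ℝ) (a : ℕ → ℝ)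
    (j r k : ℕ) (ω : Ω) : ℝ :=
  if k % (j + 1) = r then (f (filtSum c e k (j + 1) ω) - f (filtSum c e k j ω) - a k) / 4 else 0

lemma measurable_maskedDiff {Ω : Type*} [MeasurableSpace Ω] {f : ℝ → ℝ} (hf : Measurable f)
    (c : ℕ → ℝ) {e : ℤ → Ω → ℝ} (a : ℕ → ℝ) (j r k : ℕ)
    (he : k % (j + 1) = r → ∀ l < j + 1, Measurable (e ((k : ℤ) + 1 - l))) :
    Measurable (maskedDiff f c e a j r k) := by
  unfold maskedDiff
  split_ifs with h
  · have h1 := measurable_filtSum c k (j + 1) (he h)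
    have h2 := measurable_filtSum c k j fun l hl => he h l (by omega)
    exact (((hf.comp h1).sub (hf.comp h2)).sub_const _).div_const _
  · exact measurable_const

section

variable {Ω : Type*} [MeasurableSpace Ω] {P : Measure Ω} [IsProbabilityMeasure P]

/-- At an active time `n` the variable uses the noise at times `n - j + 1, …, n + 1`. The previous
active time is at most `n - (j + 1)`, so all earlier terms use noise up to time `n - j` only. -/
lemma indepFun_sum_maskedDiff {f : ℝ → ℝ} (hf : Measurable f)
    (c : ℕ → ℝ) {e : ℤ → Ω → ℝ} (he : ∀ n, Measurable (e n)) (hind : iIndepFun e P)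
    (a : ℕ → ℝ) (j r n : ℕ) :
    IndepFun (fun ω => ∑ i ∈ Finset.range n, maskedDiff f c e a j r i ω)
      (maskedDiff f c e a j r n) P := by
  by_cases hr : n % (j + 1) = r
  · have hdisj : Disjoint (Set.Iic ((n : ℤ) - j)) (Set.Ioi ((n : ℤ) - j)) :=
      Set.Iic_disjoint_Ioi le_rfl
    have hI := indep_iSup_of_disjoint (fun i => (he i).comap_le) hind hdisj
    rw [IndepFun_iff_Indep]
    refine indep_of_indep_of_le_left (indep_of_indep_of_le_right hI ?_) ?_
    · refine Measurable.comap_le ?_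
      refine @measurable_maskedDiff Ω (⨆ i ∈ Set.Ioi ((n : ℤ) - j), _) f hf c e a j r n
        fun _ l hl => Measurable.of_comap_le ?_
      exact le_iSup₂_of_le ((n : ℤ) + 1 - l) (by simp only [Set.mem_Ioi]; omega) le_rfl
    · refine Measurable.comap_le ?_
      refine @Finset.measurable_fun_sum _ _ _ _ _ _ (⨆ i ∈ Set.Iic ((n : ℤ) - j), _) _ _
        fun i hi => ?_
      refine @measurable_maskedDiff Ω (⨆ i ∈ Set.Iic ((n : ℤ) - j), _) f hf c e a j r i
        fun hir l hl => Measurable.of_comap_le ?_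
      refine le_iSup₂_of_le ((i : ℤ) + 1 - l) ?_ le_rfl
      have hin := Finset.mem_range.1 hi
      have hle : i + (j + 1) ≤ n := by
        have h1 : i ≡ n [MOD (j + 1)] := hir.trans hr.symm
        have h2 := (Nat.modEq_iff_dvd' hin.le).1 h1
        have h3 := Nat.le_of_dvd (by omega) h2
        omega
      simp only [Set.mem_Iic]; omega
  · have : maskedDiff f c e a j r n = fun _ => 0 := by
      funext ω; simp [maskedDiff, hr]
    rw [this]
    exact indepFun_const_right _ _

lemma integrable_comp_filtSum {f : ℝ → ℝ} (hf : Measurable f) (hf1 : ∀ x, |f x| ≤ 1)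
    (c : ℕ → ℝ) {e : ℤ → Ω → ℝ} (he : ∀ n, Measurable (e n)) (k J : ℕ) :
    Integrable (fun ω => f (filtSum c e k J ω)) P :=
  Integrable.of_bound (C := 1)
    (hf.comp (measurable_filtSum c k J fun _ _ => he _)).aestronglyMeasurable
    (Eventually.of_forall fun _ => hf1 _)

/-- The `L¹` size of the differences is written as `κ ^ (2 * q + 2)` because it bounds the variance,
which enters the moment of order `2 * q + 2` linearly; taking the root leaves the factor `κ`. -/
lemma eLpNorm_sum_maskedDiff_le (q : ℕ) : ∃ B : ℝ, 0 ≤ B ∧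
    ∀ (f : ℝ → ℝ) (c : ℕ → ℝ) (e : ℤ → Ω → ℝ) (a : ℕ → ℝ) (j r : ℕ) (κ : ℝ), 0 ≤ κ →
    Measurable f → (∀ x, |f x| ≤ 1) → (∀ n, Measurable (e n)) → iIndepFun e P →
    (∀ k, a k = ∫ ω, (f (filtSum c e k (j + 1) ω) - f (filtSum c e k j ω)) ∂P) →
    (∀ k, ∫ ω, |f (filtSum c e k (j + 1) ω) - f (filtSum c e k j ω)| ∂P ≤ κ ^ (2 * q + 2)) →
    ∀ N : ℕ, eLpNorm (fun ω => ∑ k ∈ Finset.range N, maskedDiff f c e a j r k ω)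
      ((2 * q + 2 : ℕ) : ENNReal) P ≤ ENNReal.ofReal (B * κ * √N) := by
  obtain ⟨C, hC, h⟩ := exists_integral_sum_pow_le (P := P) q
  refine ⟨C ^ (((2 * q + 2 : ℕ) : ℝ)⁻¹), by positivity, ?_⟩
  intro f c e a j r κ hκ hf hf1 he hind ha hd N
  have hint := integrable_comp_filtSum (P := P) hf hf1 c he
  set g : ℕ → Ω → ℝ := fun k ω => f (filtSum c e k (j + 1) ω) - f (filtSum c e k j ω) with hg
  have hgint : ∀ k, Integrable (g k) P := fun k => (hint k (j + 1)).sub (hint k j)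
  have hg2 : ∀ k ω, |g k ω| ≤ 2 := fun k ω =>
    (abs_sub _ _).trans (by linarith [hf1 (filtSum c e k (j + 1) ω), hf1 (filtSum c e k j ω)])
  have haabs : ∀ k, |a k| ≤ ∫ ω, |g k ω| ∂P := fun k => by
    rw [ha]; exact abs_integral_le_integral_abs
  have ha2 : ∀ k, |a k| ≤ 2 := fun k => by
    refine (haabs k).trans ?_
    have : ∫ ω, |g k ω| ∂P ≤ ∫ _, (2 : ℝ) ∂P :=
      integral_mono (hgint k).abs (integrable_const _) (hg2 k)
    simpa using this
  set X : ℕ → Ω → ℝ := maskedDiff f c e a j r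
  have hXm : ∀ k, Measurable (X k) := fun k => measurable_maskedDiff hf c a j r k fun _ _ _ => he _
  have hX : ∀ k ω, X k ω = if k % (j + 1) = r then (g k ω - a k) / 4 else 0 := fun k ω => rfl
  -- Both `g k` and its mean are at most `2` in modulus, whence the scaling by `4`.
  have hX1 : ∀ k ω, |X k ω| ≤ 1 := by
    intro k ω
    rw [hX]
    split_ifs
    · rw [abs_div, abs_of_pos (by norm_num : (0 : ℝ) < 4), div_le_one (by norm_num)]
      exact (abs_sub _ _).trans (by linarith [hg2 k ω, ha2 k])
    · simp
  have hX0 : ∀ k, ∫ ω, X k ω ∂P = 0 := by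
    intro k
    simp_rw [hX]
    split_ifs
    · rw [integral_div, integral_sub (hgint k) (integrable_const _), ← ha]
      simp
    · simp
  have hXint : ∀ k, Integrable (X k) P := fun k =>
    Integrable.of_bound (C := 1) (hXm k).aestronglyMeasurable (Eventually.of_forall (hX1 k))
  have hX2 : ∀ k, ∫ ω, X k ω ^ 2 ∂P ≤ κ ^ (2 * q + 2) := by
    intro k
    have h1 : ∫ ω, X k ω ^ 2 ∂P ≤ ∫ ω, |X k ω| ∂P := by
      refine integral_mono_of_nonneg (Eventually.of_forall fun ω => sq_nonneg _) (hXint k).abs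
        (Eventually.of_forall fun ω => ?_)
      simp only
      rw [← sq_abs]
      nlinarith [abs_nonneg (X k ω), hX1 k ω]
    have h2 : ∫ ω, |X k ω| ∂P ≤ ∫ ω, (|g k ω| + |a k|) / 4 ∂P := by
      refine integral_mono (hXint k).abs (((hgint k).abs.add (integrable_const _)).div_const _)
        fun ω => ?_
      simp only [hX]
      split_ifs
      · rw [abs_div, abs_of_pos (by norm_num : (0 : ℝ) < 4)]
        gcongr
        exact abs_sub _ _
      · simp only [abs_zero]; positivity
    have h3 : ∫ ω, (|g k ω| + |a k|) / 4 ∂P = ((∫ ω, |g k ω| ∂P) + |a k|) / 4 := by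
      rw [integral_div, integral_add (hgint k).abs (integrable_const _)]
      simp
    have h4 := haabs k
    have h5 : ∫ ω, |g k ω| ∂P ≤ κ ^ (2 * q + 2) := hd k
    have h6 : 0 ≤ κ ^ (2 * q + 2) := by positivity
    linarith
  have hmain := h X (κ ^ (2 * q + 2)) hXm hX1 hX0 hX2
    (indepFun_sum_maskedDiff hf c he hind a j r) N
  have heven : ∀ ω, ‖∑ k ∈ Finset.range N, X k ω‖ ^ (2 * q + 2) =
      (∑ k ∈ Finset.range N, X k ω) ^ (2 * q + 2) := fun ω => by
    rw [Real.norm_eq_abs, Even.pow_abs ⟨q + 1, by ring⟩]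
  refine eLpNorm_le_of_integral_pow_le (by omega) (by positivity) ?_ ?_
  · refine Integrable.of_bound (C := (N : ℝ) ^ (2 * q + 2)) (by fun_prop)
      (Eventually.of_forall fun ω => ?_)
    rw [norm_pow, norm_norm]
    refine pow_le_pow_left₀ (norm_nonneg _) ((norm_sum_le _ _).trans ?_) _
    exact (Finset.sum_le_sum fun k _ => hX1 k ω).trans (by simp)
  · simp_rw [heven]
    refine hmain.trans_eq ?_
    rw [mul_pow, mul_pow, Real.rpow_inv_natCast_pow hC (by omega),
      show 2 * q + 2 = 2 * (q + 1) by ring, pow_mul (√(N : ℝ)), Real.sq_sqrt (Nat.cast_nonneg _)]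
    ring

end

/-- Independent integrable noise with common characteristic function `χ`. -/
structure IsNoise {Ω : Type*} [MeasurableSpace Ω] (P : Measure Ω) (e : ℤ → Ω → ℝ) (A : ℝ)
    (χ : ℝ → ℂ) : Prop where
  measurable : ∀ n, Measurable (e n)
  indep : iIndepFun e P
  integrable : ∀ n, Integrable (e n) P
  integral_abs_le : ∀ n, ∫ ω, |e n ω| ∂P ≤ A
  charFun : ∀ n (u : ℝ), ∫ ω, Complex.exp (Complex.I * u * (e n ω : ℂ)) ∂P = χ u

section

variable {Ω : Type*} [MeasurableSpace Ω] {P : Measure Ω}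

lemma IsNoise.nonneg {e : ℤ → Ω → ℝ} {A : ℝ} {χ : ℝ → ℂ} (he : IsNoise P e A χ) : 0 ≤ A :=
  (integral_nonneg fun _ => abs_nonneg _).trans (he.integral_abs_le 0)

lemma IsNoise.integral_exp_filtSum {e : ℤ → Ω → ℝ} {A : ℝ} {χ : ℝ → ℂ} (he : IsNoise P e A χ)
    (c : ℕ → ℝ) (k J : ℕ) (u : ℝ) :
    ∫ ω, Complex.exp (Complex.I * u * filtSum c e k J ω) ∂P =
      ∏ l ∈ Finset.range J, χ (u * c l) := by
  have hinj : Function.Injective fun l : Fin J => (k : ℤ) + 1 - (l : ℕ) := fun i j hij => by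
    simp only at hij; exact Fin.ext (by omega)
  have h1 := (he.indep.precomp hinj).integral_fun_prod_comp
    (f := fun (l : Fin J) (x : ℝ) => Complex.exp (Complex.I * ((u * c l : ℝ) : ℂ) * x))
    (fun l => (he.measurable _).aemeasurable)
    (fun l => Continuous.aestronglyMeasurable (by fun_prop))
  simp only [he.charFun] at h1
  rw [Finset.prod_range, ← h1]
  refine integral_congr_ae (Eventually.of_forall fun ω => ?_)
  simp only [filtSum]
  rw [← Complex.exp_sum, Finset.sum_range]
  congr 1
  push_cast
  rw [Finset.mul_sum]
  exact Finset.sum_congr rfl fun l _ => by ring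

variable [IsProbabilityMeasure P]

/-- The telescoping starts from the empty truncation, which is constant and vanishes after centring;
each time `k` belongs to exactly one residue class `r`. -/
lemma sum_centered_filtSum_eq {f : ℝ → ℝ} (hf : Measurable f) (hf1 : ∀ x, |f x| ≤ 1)
    (c : ℕ → ℝ) {e : ℤ → Ω → ℝ} (he : ∀ n, Measurable (e n)) (N J : ℕ) (ω : Ω) :
    ∑ k ∈ Finset.range N, (f (filtSum c e k J ω) - ∫ ω, f (filtSum c e k J ω) ∂P) =
    ∑ j ∈ Finset.range J, ∑ r ∈ Finset.range (j + 1), 4 * ∑ k ∈ Finset.range N,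
      maskedDiff f c e
        (fun k => ∫ ω, (f (filtSum c e k (j + 1) ω) - f (filtSum c e k j ω)) ∂P) j r k ω := by
  have hint := integrable_comp_filtSum (P := P) hf hf1 c he
  have h1 : ∀ k, f (filtSum c e k J ω) - ∫ ω, f (filtSum c e k J ω) ∂P =
      ∑ j ∈ Finset.range J, (f (filtSum c e k (j + 1) ω) - f (filtSum c e k j ω) -
        ∫ ω, (f (filtSum c e k (j + 1) ω) - f (filtSum c e k j ω)) ∂P) := by
    intro k
    have := Finset.sum_range_sub
      (fun j => f (filtSum c e k j ω) - ∫ ω, f (filtSum c e k j ω) ∂P) J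
    rw [show f (filtSum c e k 0 ω) - ∫ ω, f (filtSum c e k 0 ω) ∂P = 0 by simp [filtSum],
      sub_zero] at this
    rw [← this]
    refine Finset.sum_congr rfl fun j _ => ?_
    rw [integral_sub (hint k (j + 1)) (hint k j)]
    ring
  simp_rw [h1]
  rw [Finset.sum_comm]
  refine Finset.sum_congr rfl fun j _ => ?_
  rw [← Finset.mul_sum, Finset.sum_comm, Finset.mul_sum]
  refine Finset.sum_congr rfl fun k _ => ?_
  simp only [maskedDiff]
  rw [Finset.sum_ite_eq, if_pos (Finset.mem_range.2 (Nat.mod_lt _ (Nat.succ_pos j)))]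
  ring

lemma exists_eLpNorm_centered_filtSum_le (q : ℕ) {U A C ρ : ℝ} (hU : 0 ≤ U) (hA : 0 ≤ A)
    (hC : 0 ≤ C) (hρ0 : 0 < ρ) (hρ1 : ρ < 1) : ∃ B : ℝ, 0 ≤ B ∧
    ∀ (f : ℝ → ℝ) (c : ℕ → ℝ) (e : ℤ → Ω → ℝ) (χ : ℝ → ℂ), IsNoise P e A χ →
    Measurable f → (∀ x, |f x| ≤ 1) → (∀ x y, |f x - f y| ≤ U * |x - y|) →
    (∀ l, |c l| ≤ C * ρ ^ l) → ∀ N J : ℕ,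
    eLpNorm (fun ω => ∑ k ∈ Finset.range N,
      (f (filtSum c e k J ω) - ∫ ω, f (filtSum c e k J ω) ∂P))
      ((2 * q + 2 : ℕ) : ENNReal) P ≤ ENNReal.ofReal (B * √N) := by
  obtain ⟨B, hB, h⟩ := eLpNorm_sum_maskedDiff_le (P := P) q
  set b : ℝ := (U * C * A) ^ (((2 * q + 2 : ℕ) : ℝ)⁻¹)
  set τ : ℝ := ρ ^ (((2 * q + 2 : ℕ) : ℝ)⁻¹)
  have hb : b ^ (2 * q + 2) = U * C * A := Real.rpow_inv_natCast_pow (by positivity) (by omega)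
  have hτ : τ ^ (2 * q + 2) = ρ := Real.rpow_inv_natCast_pow hρ0.le (by omega)
  have hb0 : 0 ≤ b := by positivity
  have hτ0 : 0 < τ := Real.rpow_pos_of_pos hρ0 _
  have hτ1 : τ < 1 := Real.rpow_lt_one hρ0.le hρ1 (by positivity)
  -- The factor `j + 1` counts the residue classes at truncation length `j`.
  have hsum : Summable fun j : ℕ => ((j : ℝ) + 1) * τ ^ j := by
    have h1 := summable_pow_mul_geometric_of_norm_lt_one 1 (r := τ)
      (by rwa [Real.norm_of_nonneg hτ0.le])
    have h2 := summable_geometric_of_lt_one hτ0.le hτ1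
    refine (h1.add h2).congr fun j => ?_
    rw [pow_one]; ring
  refine ⟨4 * B * b * ∑' j : ℕ, ((j : ℝ) + 1) * τ ^ j, mul_nonneg (by positivity)
    (tsum_nonneg fun j => by positivity), ?_⟩
  intro f c e χ he hf hf1 hfL hc N J
  simp_rw [sum_centered_filtSum_eq (P := P) hf hf1 c he.measurable]
  set a : ℕ → ℕ → ℝ := fun j k =>
    ∫ ω, (f (filtSum c e k (j + 1) ω) - f (filtSum c e k j ω)) ∂P
  set Y : ℕ → ℕ → Ω → ℝ := fun j r ω => ∑ k ∈ Finset.range N, maskedDiff f c e (a j) j r k ω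
  have hYm : ∀ j r, Measurable (Y j r) := fun j r => Finset.measurable_fun_sum _ fun k _ =>
    measurable_maskedDiff hf c (a j) j r k fun _ _ _ => he.measurable _
  have hY : ∀ j r, eLpNorm ((4 : ℝ) • Y j r) ((2 * q + 2 : ℕ) : ENNReal) P ≤
      ENNReal.ofReal (4 * (B * (b * τ ^ j) * √N)) := by
    intro j r
    have hκ : (b * τ ^ j) ^ (2 * q + 2) = U * C * A * ρ ^ j := by
      rw [mul_pow, hb, ← pow_mul, mul_comm j, pow_mul, hτ]
    have hYjr := h f c e (a j) j r (b * τ ^ j) (by positivity) hf hf1 he.measurable he.indep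
      (fun k => rfl) (fun k => by
        rw [hκ]
        have hle : ∫ ω, |f (filtSum c e k (j + 1) ω) - f (filtSum c e k j ω)| ∂P ≤
            ∫ ω, U * (C * ρ ^ j) * |e ((k : ℤ) + 1 - j) ω| ∂P := by
          refine integral_mono_of_nonneg (Eventually.of_forall fun ω => abs_nonneg _)
            ((he.integrable _).abs.const_mul _) (Eventually.of_forall fun ω => ?_)
          refine (hfL _ _).trans ?_
          rw [filtSum_succ, add_sub_cancel_left, abs_mul, ← mul_assoc]
          exact mul_le_mul_of_nonneg_right (mul_le_mul_of_nonneg_left (hc j) hU) (abs_nonneg _)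
        refine hle.trans ?_
        rw [integral_const_mul]
        calc _ ≤ U * (C * ρ ^ j) * A := by gcongr; exact he.integral_abs_le _
          _ = _ := by ring) N
    rw [eLpNorm_const_smul, ENNReal.ofReal_mul (by norm_num)]
    refine mul_le_mul' ?_ hYjr
    rw [Real.enorm_eq_ofReal (by norm_num)]
  have hp : (1 : ENNReal) ≤ ((2 * q + 2 : ℕ) : ENNReal) := by exact_mod_cast (by omega)
  have heq : (fun ω => ∑ j ∈ Finset.range J, ∑ r ∈ Finset.range (j + 1),
      4 * ∑ k ∈ Finset.range N, maskedDiff f c e (a j) j r k ω) =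
      ∑ j ∈ Finset.range J, ∑ r ∈ Finset.range (j + 1), (4 : ℝ) • Y j r := by
    funext ω; simp [Y, Finset.sum_apply]
  rw [heq]
  have hsm : ∀ j r, AEStronglyMeasurable ((4 : ℝ) • Y j r) P := fun j r =>
    ((hYm j r).const_smul (4 : ℝ)).aestronglyMeasurable
  calc _ ≤ ∑ j ∈ Finset.range J, eLpNorm (∑ r ∈ Finset.range (j + 1), (4 : ℝ) • Y j r)
        ((2 * q + 2 : ℕ) : ENNReal) P :=
        eLpNorm_sum_le (fun j _ => Finset.aestronglyMeasurable_sum _ fun r _ => hsm j r) hp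
    _ ≤ ∑ j ∈ Finset.range J, ∑ r ∈ Finset.range (j + 1),
        ENNReal.ofReal (4 * (B * (b * τ ^ j) * √N)) :=
        Finset.sum_le_sum fun j _ => (eLpNorm_sum_le (fun r _ => hsm j r) hp).trans
          (Finset.sum_le_sum fun r _ => hY j r)
    _ = ENNReal.ofReal (∑ j ∈ Finset.range J, ∑ r ∈ Finset.range (j + 1),
        (4 * (B * (b * τ ^ j) * √N))) := by
        rw [ENNReal.ofReal_sum_of_nonneg fun j _ => Finset.sum_nonneg fun r _ => by positivity]
        refine Finset.sum_congr rfl fun j _ => ?_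
        rw [ENNReal.ofReal_sum_of_nonneg fun r _ => by positivity]
    _ ≤ _ := by
        refine ENNReal.ofReal_le_ofReal ?_
        have h1 : ∑ j ∈ Finset.range J, ∑ r ∈ Finset.range (j + 1),
            (4 * (B * (b * τ ^ j) * √N)) =
            4 * B * b * (∑ j ∈ Finset.range J, ((j : ℝ) + 1) * τ ^ j) * √N := by
          rw [Finset.mul_sum, Finset.sum_mul]
          refine Finset.sum_congr rfl fun j _ => ?_
          simp; ring
        rw [h1]
        gcongr
        exact hsum.sum_le_tsum _ fun j _ => by positivity

lemma norm_exp_I_mul_ofReal (u x : ℝ) : ‖Complex.exp (Complex.I * u * x)‖ = 1 := by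
  rw [show Complex.I * u * (x : ℂ) = ((u * x : ℝ) : ℂ) * Complex.I by push_cast; ring,
    Complex.norm_exp_ofReal_mul_I]

lemma norm_exp_I_mul_sub_le (u x y : ℝ) :
    ‖Complex.exp (Complex.I * u * x) - Complex.exp (Complex.I * u * y)‖ ≤ |u| * |x - y| := by
  have h : Complex.exp (Complex.I * u * x) - Complex.exp (Complex.I * u * y) =
      Complex.exp (Complex.I * u * y) * (Complex.exp (Complex.I * ((u * (x - y) : ℝ) : ℂ)) - 1) := by
    rw [mul_sub, ← Complex.exp_add, mul_one]
    congr 2; push_cast; ring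
  rw [h, norm_mul, norm_exp_I_mul_ofReal, one_mul, ← abs_mul]
  exact norm_exp_I_mul_sub_one_le _

lemma integrable_exp_I_mul {X : Ω → ℝ} (hX : AEStronglyMeasurable X P) (u : ℝ) :
    Integrable (fun ω => Complex.exp (Complex.I * u * (X ω : ℂ))) P := by
  refine Integrable.of_bound (C := 1) ?_ (Eventually.of_forall fun ω =>
    (norm_exp_I_mul_ofReal _ _).le)
  have : Continuous fun x : ℝ => Complex.exp (Complex.I * u * (x : ℂ)) := by fun_prop
  exact this.comp_aestronglyMeasurable hX

lemma exp_I_mul_re (u x : ℝ) : (Complex.exp (Complex.I * u * x)).re = Real.cos (u * x) := by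
  rw [show Complex.I * u * (x : ℂ) = ((u * x : ℝ) : ℂ) * Complex.I by push_cast; ring,
    Complex.exp_ofReal_mul_I_re]

lemma exp_I_mul_im (u x : ℝ) : (Complex.exp (Complex.I * u * x)).im = Real.sin (u * x) := by
  rw [show Complex.I * u * (x : ℂ) = ((u * x : ℝ) : ℂ) * Complex.I by push_cast; ring,
    Complex.exp_ofReal_mul_I_im]

lemma exists_eLpNorm_centered_exp_filtSum_le (q : ℕ) (u : ℝ) {A C ρ : ℝ} (hA : 0 ≤ A)
    (hC : 0 ≤ C) (hρ0 : 0 < ρ) (hρ1 : ρ < 1) : ∃ B : ℝ, 0 ≤ B ∧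
    ∀ (c : ℕ → ℝ) (e : ℤ → Ω → ℝ) (χ : ℝ → ℂ), IsNoise P e A χ →
    (∀ l, |c l| ≤ C * ρ ^ l) → ∀ N J : ℕ,
    eLpNorm (fun ω => ∑ k ∈ Finset.range N, (Complex.exp (Complex.I * u * filtSum c e k J ω) -
      ∫ ω, Complex.exp (Complex.I * u * filtSum c e k J ω) ∂P))
      ((2 * q + 2 : ℕ) : ENNReal) P ≤ ENNReal.ofReal (B * √N) := by
  obtain ⟨B, hB, h⟩ := exists_eLpNorm_centered_filtSum_le (P := P) q (abs_nonneg u) hA hC hρ0 hρ1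
  refine ⟨B + B, by positivity, fun c e χ he hc N J => ?_⟩
  have hTm : ∀ k, Measurable (filtSum c e k J) := fun k =>
    measurable_filtSum c k J fun _ _ => he.measurable _
  have hexp := fun k => integrable_exp_I_mul (P := P) (hTm k).aestronglyMeasurable u
  have hre : ∀ x y : ℝ, |Real.cos (u * x) - Real.cos (u * y)| ≤ |u| * |x - y| := fun x y => by
    rw [← exp_I_mul_re, ← exp_I_mul_re, ← Complex.sub_re]
    exact (Complex.abs_re_le_norm _).trans (norm_exp_I_mul_sub_le u x y)
  have him : ∀ x y : ℝ, |Real.sin (u * x) - Real.sin (u * y)| ≤ |u| * |x - y| := fun x y => by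
    rw [← exp_I_mul_im, ← exp_I_mul_im, ← Complex.sub_im]
    exact (Complex.abs_im_le_norm _).trans (norm_exp_I_mul_sub_le u x y)
  have h1 := h (fun x => Real.cos (u * x)) c e χ he (by fun_prop) (fun _ => Real.abs_cos_le_one _)
    hre hc N J
  have h2 := h (fun x => Real.sin (u * x)) c e χ he (by fun_prop) (fun _ => Real.abs_sin_le_one _)
    him hc N J
  have hp : (1 : ENNReal) ≤ ((2 * q + 2 : ℕ) : ENNReal) := by exact_mod_cast (by omega)
  set Y₁ : Ω → ℝ := fun ω => ∑ k ∈ Finset.range N,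
    (Real.cos (u * filtSum c e k J ω) - ∫ ω, Real.cos (u * filtSum c e k J ω) ∂P)
  set Y₂ : Ω → ℝ := fun ω => ∑ k ∈ Finset.range N,
    (Real.sin (u * filtSum c e k J ω) - ∫ ω, Real.sin (u * filtSum c e k J ω) ∂P)
  have hY₁ : AEStronglyMeasurable Y₁ P := by
    refine Measurable.aestronglyMeasurable ?_
    fun_prop
  have hY₂ : AEStronglyMeasurable Y₂ P := by
    refine Measurable.aestronglyMeasurable ?_
    fun_prop
  calc _ ≤ eLpNorm (fun ω => |Y₁ ω| + |Y₂ ω|) ((2 * q + 2 : ℕ) : ENNReal) P := by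
        refine eLpNorm_mono_real fun ω => ?_
        refine (Complex.norm_le_abs_re_add_abs_im _).trans_eq ?_
        simp only [Complex.re_sum, Complex.im_sum, Complex.sub_re, Complex.sub_im, exp_I_mul_re,
          exp_I_mul_im, Y₁, Y₂]
        have e1 : ∀ k, (∫ ω, Complex.exp (Complex.I * u * filtSum c e k J ω) ∂P).re =
            ∫ ω, Real.cos (u * filtSum c e k J ω) ∂P := fun k =>
          (integral_re (hexp k)).symm.trans
            (integral_congr_ae (Eventually.of_forall fun ω => exp_I_mul_re _ _))
        have e2 : ∀ k, (∫ ω, Complex.exp (Complex.I * u * filtSum c e k J ω) ∂P).im =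
            ∫ ω, Real.sin (u * filtSum c e k J ω) ∂P := fun k =>
          (integral_im (hexp k)).symm.trans
            (integral_congr_ae (Eventually.of_forall fun ω => exp_I_mul_im _ _))
        simp_rw [e1, e2]
    _ ≤ eLpNorm (fun ω => |Y₁ ω|) ((2 * q + 2 : ℕ) : ENNReal) P +
        eLpNorm (fun ω => |Y₂ ω|) ((2 * q + 2 : ℕ) : ENNReal) P :=
        eLpNorm_add_le hY₁.norm hY₂.norm hp
    _ = eLpNorm Y₁ ((2 * q + 2 : ℕ) : ENNReal) P +
        eLpNorm Y₂ ((2 * q + 2 : ℕ) : ENNReal) P := by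
        congr 1
        · exact eLpNorm_norm Y₁
        · exact eLpNorm_norm Y₂
    _ ≤ ENNReal.ofReal (B * √N) + ENNReal.ofReal (B * √N) := add_le_add h1 h2
    _ = _ := by rw [← ENNReal.ofReal_add (by positivity) (by positivity), add_mul]

end

/-! ### Passage to the infinite moving average -/

section

variable {Ω : Type*} [MeasurableSpace Ω] {P : Measure Ω}

lemma IsNoise.ae_summable {e : ℤ → Ω → ℝ} {A : ℝ} {χ : ℝ → ℂ} (he : IsNoise P e A χ)
    {ι : Type*} [Countable ι] {w : ι → ℝ} (hw0 : ∀ i, 0 ≤ w i) (hw : Summable w) (t : ι → ℤ) :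
    ∀ᵐ ω ∂P, Summable fun i => w i * |e (t i) ω| := by
  have hm : ∀ i, AEStronglyMeasurable (fun ω => w i * |e (t i) ω|) P := fun i =>
    ((he.integrable (t i)).abs.const_mul _).aestronglyMeasurable
  have hfin : ∑' i, ∫⁻ ω, ‖w i * |e (t i) ω|‖ₑ ∂P ≠ ⊤ := by
    have hle : ∀ i, ∫⁻ ω, ‖w i * |e (t i) ω|‖ₑ ∂P ≤ ENNReal.ofReal (w i * A) := by
      intro i
      rw [← ofReal_integral_norm_eq_lintegral_enorm ((he.integrable (t i)).abs.const_mul _)]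
      refine ENNReal.ofReal_le_ofReal ?_
      simp_rw [norm_mul, Real.norm_eq_abs, abs_abs, abs_of_nonneg (hw0 i)]
      rw [integral_const_mul]
      exact mul_le_mul_of_nonneg_left (he.integral_abs_le _) (hw0 i)
    refine ne_top_of_le_ne_top ?_ (ENNReal.tsum_le_tsum hle)
    exact (hw.mul_right A).tsum_ofReal_ne_top
  rw [← lintegral_tsum fun i => (hm i).enorm] at hfin
  have hae := ae_lt_top' (AEMeasurable.tsum fun i => (hm i).enorm) hfin
  filter_upwards [hae] with ω hω
  have h2 : Summable fun i => ‖w i * |e (t i) ω|‖₊ := ENNReal.tsum_coe_ne_top_iff_summable.1 hω.ne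
  refine (NNReal.summable_coe.2 h2).congr fun i => ?_
  rw [coe_nnnorm, Real.norm_of_nonneg (mul_nonneg (hw0 i) (abs_nonneg _))]

lemma sum_Ico_geometric_le {ρ : ℝ} (hρ0 : 0 < ρ) (hρ1 : ρ < 1) (m N : ℕ) :
    ∑ l ∈ Finset.Ico m N, ρ ^ l ≤ ρ ^ m / (1 - ρ) := by
  rw [Finset.sum_Ico_eq_sum_range]
  simp_rw [pow_add]
  rw [← Finset.mul_sum, div_eq_mul_inv, ← tsum_geometric_of_lt_one hρ0.le hρ1]
  gcongr
  exact (summable_geometric_of_lt_one hρ0.le hρ1).sum_le_tsum _ fun _ _ => by positivity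

lemma IsNoise.integral_abs_filtSum_sub_le {e : ℤ → Ω → ℝ} {A : ℝ} {χ : ℝ → ℂ}
    (he : IsNoise P e A χ) {c : ℕ → ℝ} {C ρ : ℝ} (hC : 0 ≤ C) (hρ0 : 0 < ρ) (hρ1 : ρ < 1)
    (hc : ∀ l, |c l| ≤ C * ρ ^ l) (k : ℕ) {m N : ℕ} (hmN : m ≤ N) :
    Integrable (fun ω => filtSum c e k N ω - filtSum c e k m ω) P ∧
    ∫ ω, |filtSum c e k N ω - filtSum c e k m ω| ∂P ≤ C * A / (1 - ρ) * ρ ^ m := by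
  have heq : ∀ ω, filtSum c e k N ω - filtSum c e k m ω =
      ∑ l ∈ Finset.Ico m N, c l * e ((k : ℤ) + 1 - l) ω := fun ω =>
    (Finset.sum_Ico_eq_sub _ hmN).symm
  have hi : ∀ l, Integrable (fun ω => c l * e ((k : ℤ) + 1 - l) ω) P := fun l =>
    (he.integrable _).const_mul _
  simp_rw [heq]
  refine ⟨integrable_finsetSum _ fun l _ => hi l, ?_⟩
  calc _ ≤ ∫ ω, ∑ l ∈ Finset.Ico m N, |c l * e ((k : ℤ) + 1 - l) ω| ∂P :=
        integral_mono (integrable_finsetSum _ fun l _ => hi l).abs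
          (integrable_finsetSum _ fun l _ => (hi l).abs) fun ω => Finset.abs_sum_le_sum_abs _ _
    _ = ∑ l ∈ Finset.Ico m N, |c l| * ∫ ω, |e ((k : ℤ) + 1 - l) ω| ∂P := by
        rw [integral_finsetSum _ fun l _ => (hi l).abs]
        simp_rw [abs_mul, integral_const_mul]
    _ ≤ ∑ l ∈ Finset.Ico m N, (C * ρ ^ l) * A := Finset.sum_le_sum fun l _ => by
        gcongr
        exacts [hc l, he.integral_abs_le _]
    _ = C * A * ∑ l ∈ Finset.Ico m N, ρ ^ l := by
        rw [Finset.mul_sum]; exact Finset.sum_congr rfl fun l _ => by ring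
    _ ≤ C * A * (ρ ^ m / (1 - ρ)) := by
        have := he.nonneg
        gcongr
        exact sum_Ico_geometric_le hρ0 hρ1 m N
    _ = _ := by ring

/-- The infinite moving average is the `L¹` limit of its truncations. -/
lemma IsNoise.lintegral_tsum_sub_filtSum_le {e : ℤ → Ω → ℝ} {A : ℝ} {χ : ℝ → ℂ}
    (he : IsNoise P e A χ) {c : ℕ → ℝ} {C ρ : ℝ} (hC : 0 ≤ C) (hρ0 : 0 < ρ) (hρ1 : ρ < 1)
    (hc : ∀ l, |c l| ≤ C * ρ ^ l) :
    AEStronglyMeasurable (fun ω => ∑' l : ℕ, c l * e (1 - (l : ℤ)) ω) P ∧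
    ∀ N, ∫⁻ ω, ‖(∑' l : ℕ, c l * e (1 - (l : ℤ)) ω) - filtSum c e 0 N ω‖ₑ ∂P ≤
      ENNReal.ofReal (C * A / (1 - ρ) * ρ ^ N) := by
  have hsum : ∀ᵐ ω ∂P, Summable fun l : ℕ => c l * e (1 - (l : ℤ)) ω := by
    filter_upwards [he.ae_summable (w := fun l : ℕ => C * ρ ^ l) (fun l => by positivity)
      ((summable_geometric_of_lt_one hρ0.le hρ1).mul_left C) (fun l : ℕ => 1 - (l : ℤ))] with ω hω
    refine Summable.of_norm_bounded hω fun l => ?_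
    rw [Real.norm_eq_abs, abs_mul]
    gcongr
    exact hc l
  have hT : ∀ N ω, filtSum c e 0 N ω = ∑ l ∈ Finset.range N, c l * e (1 - (l : ℤ)) ω := fun N ω => by
    simp [filtSum]
  have hTm : ∀ N, Measurable (filtSum c e 0 N) := fun N =>
    measurable_filtSum c 0 N fun _ _ => he.measurable _
  have hlim : ∀ᵐ ω ∂P, Tendsto (fun N => filtSum c e 0 N ω) atTop
      (𝓝 (∑' l : ℕ, c l * e (1 - (l : ℤ)) ω)) := by
    filter_upwards [hsum] with ω hω
    simp_rw [hT]
    exact hω.hasSum.tendsto_sum_nat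
  refine ⟨aestronglyMeasurable_of_tendsto_ae atTop (fun N => (hTm N).aestronglyMeasurable) hlim,
    fun N => ?_⟩
  -- Fatou's lemma carries the bound for finite tails, uniform in the upper end `m`, to the infinite
  -- tail.
  calc _ ≤ ∫⁻ ω, liminf (fun m => ‖filtSum c e 0 m ω - filtSum c e 0 N ω‖ₑ) atTop ∂P := by
        refine lintegral_mono_ae ?_
        filter_upwards [hlim] with ω hω
        exact ((hω.sub_const _).enorm).liminf_eq.ge
    _ ≤ liminf (fun m => ∫⁻ ω, ‖filtSum c e 0 m ω - filtSum c e 0 N ω‖ₑ ∂P) atTop :=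
        lintegral_liminf_le fun m => ((hTm m).sub (hTm N)).enorm
    _ ≤ _ := by
        refine liminf_le_of_frequently_le' (Eventually.frequently ?_)
        filter_upwards [eventually_ge_atTop N] with m hm
        obtain ⟨h1, h2⟩ := he.integral_abs_filtSum_sub_le hC hρ0 hρ1 hc 0 hm
        rw [← ofReal_integral_norm_eq_lintegral_enorm h1]
        exact ENNReal.ofReal_le_ofReal h2

variable [IsProbabilityMeasure P]

lemma IsNoise.norm_integral_exp_tsum_sub_le {e : ℤ → Ω → ℝ} {A : ℝ} {χ : ℝ → ℂ}
    (he : IsNoise P e A χ) {c : ℕ → ℝ} {C ρ : ℝ} (hC : 0 ≤ C) (hρ0 : 0 < ρ) (hρ1 : ρ < 1)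
    (hc : ∀ l, |c l| ≤ C * ρ ^ l) (u : ℝ) (N : ℕ) :
    ‖(∫ ω, Complex.exp (Complex.I * u * ((∑' l : ℕ, c l * e (1 - (l : ℤ)) ω : ℝ) : ℂ)) ∂P) -
      ∏ l ∈ Finset.range N, χ (u * c l)‖ ≤ |u| * (C * A / (1 - ρ)) * ρ ^ N := by
  obtain ⟨hm, hle⟩ := he.lintegral_tsum_sub_filtSum_le hC hρ0 hρ1 hc
  have hTm : Measurable (filtSum c e 0 N) := measurable_filtSum c 0 N fun _ _ => he.measurable _
  have h1ρ : 0 < 1 - ρ := sub_pos.2 hρ1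
  have hA := he.nonneg
  set Y : Ω → ℝ := fun ω => ∑' l : ℕ, c l * e (1 - (l : ℤ)) ω
  have hint : Integrable (fun ω => Y ω - filtSum c e 0 N ω) P :=
    ⟨hm.sub hTm.aestronglyMeasurable, (hle N).trans_lt ENNReal.ofReal_lt_top⟩
  have habs : ∫ ω, |Y ω - filtSum c e 0 N ω| ∂P ≤ C * A / (1 - ρ) * ρ ^ N := by
    have := hle N
    rw [← ofReal_integral_norm_eq_lintegral_enorm hint,
      ENNReal.ofReal_le_ofReal_iff (by positivity)] at this
    exact this
  rw [← he.integral_exp_filtSum c 0 N u, ← integral_sub (integrable_exp_I_mul hm u)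
    (integrable_exp_I_mul hTm.aestronglyMeasurable u)]
  refine (norm_integral_le_of_norm_le (hint.abs.const_mul |u|)
    (Eventually.of_forall fun ω => norm_exp_I_mul_sub_le u _ _)).trans ?_
  rw [integral_const_mul, mul_assoc]
  gcongr

/-- A difference of two unimodular numbers is at most `2`, so its power of order `2 * q + 2` is at
most `2 ^ (2 * q + 1)` times the difference itself: an `L¹` bound yields an `L^{2q+2}` bound, with a
root. -/
lemma eLpNorm_exp_sub_exp_le (q : ℕ) {X Y : Ω → ℝ} (hX : AEStronglyMeasurable X P)
    (hY : AEStronglyMeasurable Y P) (u : ℝ) {κ : ℝ} (hκ : 0 ≤ κ) {g : Ω → ℝ} (hg : Integrable g P)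
    (hXY : ∀ ω, |X ω - Y ω| ≤ g ω)
    (h : 2 ^ (2 * q + 1) * |u| * ∫ ω, g ω ∂P ≤ κ ^ (2 * q + 2)) :
    eLpNorm (fun ω => Complex.exp (Complex.I * u * X ω) - Complex.exp (Complex.I * u * Y ω))
      ((2 * q + 2 : ℕ) : ENNReal) P ≤ ENNReal.ofReal κ := by
  have hle : ∀ ω, ‖Complex.exp (Complex.I * u * X ω) - Complex.exp (Complex.I * u * Y ω)‖ ≤ 2 :=
    fun ω => (norm_sub_le _ _).trans (by rw [norm_exp_I_mul_ofReal, norm_exp_I_mul_ofReal]; norm_num)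
  refine eLpNorm_le_of_integral_pow_le (by omega) hκ ?_ (le_trans ?_ h)
  · refine Integrable.of_bound (C := 2 ^ (2 * q + 2)) ?_ (Eventually.of_forall fun ω => ?_)
    · exact ((integrable_exp_I_mul hX u).sub
        (integrable_exp_I_mul hY u)).aestronglyMeasurable.norm.pow _
    · rw [norm_pow, norm_norm]
      exact pow_le_pow_left₀ (norm_nonneg _) (hle ω) _
  · rw [← integral_const_mul]
    refine integral_mono_of_nonneg (Eventually.of_forall fun ω => by positivity)
      (hg.const_mul _) (Eventually.of_forall fun ω => ?_)
    simp only
    rw [pow_succ _ (2 * q + 1), mul_assoc (2 ^ (2 * q + 1)) |u|]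
    refine mul_le_mul (pow_le_pow_left₀ (norm_nonneg _) (hle ω) _) ?_ (norm_nonneg _)
      (by positivity)
    exact (norm_exp_I_mul_sub_le u _ _).trans
      (mul_le_mul_of_nonneg_left (hXY ω) (abs_nonneg u))

/-- Averages of `exp(iuε)` along a sequence that is exponentially close to the stationary moving
average converge at rate `N^{-1/2}` in all `L^q`. -/
lemma exists_eLpNorm_sum_exp_sub_le (q : ℕ) (u : ℝ) {A C ρ : ℝ} (hA : 0 ≤ A)
    (hC : 0 ≤ C) (hρ0 : 0 < ρ) (hρ1 : ρ < 1) {R : Ω → ℝ} (hR : Integrable R P)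
    (hR0 : ∀ ω, 0 ≤ R ω) : ∃ B : ℝ, 0 ≤ B ∧
    ∀ (c : ℕ → ℝ) (e : ℤ → Ω → ℝ) (χ : ℝ → ℂ) (ε : ℕ → Ω → ℝ), IsNoise P e A χ →
    (∀ l, |c l| ≤ C * ρ ^ l) → (∀ k, AEStronglyMeasurable (ε k) P) →
    (∀ k ω, |ε k ω - filtSum c e k (k + 1) ω| ≤ C * ρ ^ k * R ω) → ∀ N : ℕ, 1 ≤ N →
    eLpNorm (fun ω => ∑ k ∈ Finset.range N, (Complex.exp (Complex.I * u * ε k ω) -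
      ∫ ω, Complex.exp (Complex.I * u * ((∑' l : ℕ, c l * e (1 - (l : ℤ)) ω : ℝ) : ℂ)) ∂P))
      ((2 * q + 2 : ℕ) : ENNReal) P ≤ ENNReal.ofReal (B * √N) := by
  obtain ⟨B, hB, h⟩ := exists_eLpNorm_centered_exp_filtSum_le (P := P) q u hA hC hρ0 hρ1
  have h1ρ : 0 < 1 - ρ := sub_pos.2 hρ1
  have hRint : 0 ≤ ∫ ω, R ω ∂P := integral_nonneg hR0
  -- The two terms come from the initial state and from lengthening the truncation from `k + 1` to
  -- `N` terms.
  set b₀ : ℝ := 2 ^ (2 * q + 1) * |u| * (C * (∫ ω, R ω ∂P) + C * A / (1 - ρ))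
  have hb₀ : 0 ≤ b₀ := by positivity
  set b : ℝ := b₀ ^ (((2 * q + 2 : ℕ) : ℝ)⁻¹)
  set τ : ℝ := ρ ^ (((2 * q + 2 : ℕ) : ℝ)⁻¹)
  have hb : b ^ (2 * q + 2) = b₀ := Real.rpow_inv_natCast_pow hb₀ (by omega)
  have hτ : τ ^ (2 * q + 2) = ρ := Real.rpow_inv_natCast_pow hρ0.le (by omega)
  have hb0 : 0 ≤ b := by positivity
  have hτ0 : 0 < τ := Real.rpow_pos_of_pos hρ0 _
  have hτ1 : τ < 1 := Real.rpow_lt_one hρ0.le hρ1 (by positivity)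
  obtain ⟨G, r, hG, hr, hr1, hGr⟩ := exists_succ_mul_pow_le hρ0 hρ1
  set B' : ℝ := |u| * (C * A / (1 - ρ)) * G
  have hB' : 0 ≤ B' := by positivity
  refine ⟨b * (1 - τ)⁻¹ + B + B', by
    have : 0 < 1 - τ := sub_pos.2 hτ1
    positivity, ?_⟩
  intro c e χ ε he hc hε hεT N hN
  set m : ℂ := ∫ ω, Complex.exp (Complex.I * u * ((∑' l : ℕ, c l * e (1 - (l : ℤ)) ω : ℝ) : ℂ)) ∂P
  set μ : ℂ := ∏ l ∈ Finset.range N, χ (u * c l)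
  have hμ : ∀ k, ∫ ω, Complex.exp (Complex.I * u * filtSum c e k N ω) ∂P = μ := fun k =>
    he.integral_exp_filtSum c k N u
  have hTm : ∀ k j, AEStronglyMeasurable (filtSum c e k j) P := fun k j =>
    (measurable_filtSum c k j fun _ _ => he.measurable _).aestronglyMeasurable
  have hp : (1 : ENNReal) ≤ ((2 * q + 2 : ℕ) : ENNReal) := by exact_mod_cast (by omega)
  set Y : ℕ → Ω → ℂ := fun k ω =>
    Complex.exp (Complex.I * u * ε k ω) - Complex.exp (Complex.I * u * filtSum c e k N ω)
  have hYm : ∀ k, AEStronglyMeasurable (Y k) P := fun k =>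
    ((integrable_exp_I_mul (hε k) u).sub (integrable_exp_I_mul (hTm k N) u)).aestronglyMeasurable
  have hY : ∀ k ∈ Finset.range N, eLpNorm (Y k) ((2 * q + 2 : ℕ) : ENNReal) P ≤
      ENNReal.ofReal (b * τ ^ k) := by
    intro k hk
    obtain ⟨hi, hle⟩ := he.integral_abs_filtSum_sub_le hC hρ0 hρ1 hc k
      (show k + 1 ≤ N from Finset.mem_range.1 hk)
    refine eLpNorm_exp_sub_exp_le q (hε k) (hTm k N) u (by positivity)
      (g := fun ω => C * ρ ^ k * R ω + |filtSum c e k N ω - filtSum c e k (k + 1) ω|)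
      ((hR.const_mul _).add hi.abs) (fun ω => ?_) ?_
    · have h1 := hεT k ω
      have h2 := abs_sub_le (ε k ω) (filtSum c e k (k + 1) ω) (filtSum c e k N ω)
      rw [abs_sub_comm (filtSum c e k (k + 1) ω)] at h2
      linarith
    · rw [integral_add (hR.const_mul _) hi.abs, integral_const_mul, mul_pow, hb, ← pow_mul,
        mul_comm k, pow_mul, hτ]
      simp only [b₀]
      rw [mul_assoc (2 ^ (2 * q + 1) * |u|)]
      refine mul_le_mul_of_nonneg_left ?_ (by positivity)
      have h3 : C * A / (1 - ρ) * ρ ^ (k + 1) ≤ C * A / (1 - ρ) * ρ ^ k :=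
        mul_le_mul_of_nonneg_left (pow_le_pow_of_le_one hρ0.le hρ1.le (Nat.le_succ k))
          (by positivity)
      linarith
  set Y₂ : Ω → ℂ := fun ω => ∑ k ∈ Finset.range N,
    (Complex.exp (Complex.I * u * filtSum c e k N ω) - μ)
  have hY₂m : AEStronglyMeasurable Y₂ P :=
    Finset.aestronglyMeasurable_fun_sum _ fun k _ =>
      ((integrable_exp_I_mul (hTm k N) u).sub (integrable_const μ)).aestronglyMeasurable
  have hY₂ : eLpNorm Y₂ ((2 * q + 2 : ℕ) : ENNReal) P ≤ ENNReal.ofReal (B * √N) := by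
    have := h c e χ he hc N N
    simp_rw [hμ] at this
    exact this
  have hmμ : ‖(N : ℂ) * (μ - m)‖ ≤ B' := by
    have h1 := he.norm_integral_exp_tsum_sub_le hC hρ0 hρ1 hc u N
    rw [norm_mul, Complex.norm_natCast, norm_sub_rev]
    have h2 : (N : ℝ) * ρ ^ N ≤ G := by
      have h3 := hGr N
      have h4 : r ^ N ≤ 1 := pow_le_one₀ (hρ0.le.trans hr) hr1.le
      have h5 : 0 ≤ ρ ^ N := by positivity
      nlinarith
    calc (N : ℝ) * ‖m - μ‖ ≤ N * (|u| * (C * A / (1 - ρ)) * ρ ^ N) := by gcongr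
      _ = |u| * (C * A / (1 - ρ)) * (N * ρ ^ N) := by ring
      _ ≤ _ := mul_le_mul_of_nonneg_left h2 (by positivity)
  have hY₃ : eLpNorm (fun _ : Ω => (N : ℂ) * (μ - m)) ((2 * q + 2 : ℕ) : ENNReal) P ≤
      ENNReal.ofReal B' := by
    rw [eLpNorm_const _ (by simp) (IsProbabilityMeasure.ne_zero P), measure_univ, ENNReal.one_rpow,
      mul_one, ← ofReal_norm]
    exact ENNReal.ofReal_le_ofReal hmμ
  -- Three errors: replacing each `ε k` by the truncation of common length `N`, with geometrically
  -- summable norms; the centred sum of these truncations, whose mean `μ` is the same for all `k`;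
  -- and the bias `N (μ - m)`, bounded because it is of order `N ρ ^ N`.
  have heq : (fun ω => ∑ k ∈ Finset.range N, (Complex.exp (Complex.I * u * ε k ω) - m)) =
      ∑ k ∈ Finset.range N, Y k + Y₂ + fun _ : Ω => (N : ℂ) * (μ - m) := by
    funext ω
    simp only [Pi.add_apply, Finset.sum_apply, Y, Y₂, Finset.sum_sub_distrib]
    simp; ring
  have hN1 : (1 : ℝ) ≤ √N := Real.one_le_sqrt.2 (by exact_mod_cast hN)
  have hgeom : ∑ k ∈ Finset.range N, τ ^ k ≤ (1 - τ)⁻¹ := by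
    rw [← tsum_geometric_of_lt_one hτ0.le hτ1]
    exact (summable_geometric_of_lt_one hτ0.le hτ1).sum_le_tsum _ fun _ _ => by positivity
  have hτinv : 0 < (1 - τ)⁻¹ := inv_pos.2 (sub_pos.2 hτ1)
  have hYs : eLpNorm (∑ k ∈ Finset.range N, Y k) ((2 * q + 2 : ℕ) : ENNReal) P ≤
      ENNReal.ofReal (b * (1 - τ)⁻¹) := by
    refine (eLpNorm_sum_le (fun k _ => hYm k) hp).trans ((Finset.sum_le_sum hY).trans ?_)
    rw [← ENNReal.ofReal_sum_of_nonneg fun k _ => by positivity, ← Finset.mul_sum]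
    refine ENNReal.ofReal_le_ofReal ?_
    gcongr
  rw [heq]
  have hYsm : AEStronglyMeasurable (∑ k ∈ Finset.range N, Y k) P :=
    Finset.aestronglyMeasurable_sum _ fun k _ => hYm k
  refine (eLpNorm_add_le (hYsm.add hY₂m) aestronglyMeasurable_const hp).trans ?_
  refine (add_le_add ((eLpNorm_add_le hYsm hY₂m hp).trans (add_le_add hYs hY₂)) hY₃).trans ?_
  rw [← ENNReal.ofReal_add (by positivity) (by positivity),
    ← ENNReal.ofReal_add (by positivity) (by positivity)]
  refine ENNReal.ofReal_le_ofReal ?_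
  have h1 : b * (1 - τ)⁻¹ ≤ b * (1 - τ)⁻¹ * √N := le_mul_of_one_le_right (by positivity) hN1
  have h2 : B' ≤ B' * √N := le_mul_of_one_le_right hB' hN1
  linarith

end

/-! ### Lipschitz dependence of nondegenerate zeros -/

section

variable {V F : Type*} [NormedAddCommGroup V] [NormedSpace ℝ V] [NormedAddCommGroup F]
  [NormedSpace ℝ F]

/-- A nondegenerate zero persists under perturbation of the parameter. -/
lemma eventually_exists_zero [CompleteSpace V] [CompleteSpace F] {g : V × F → F}
    {g' : V × F →L[ℝ] F} {v : V} {η : F}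
    (hg : HasStrictFDerivAt g g' (v, η)) (h0 : g (v, η) = 0)
    (hsurj : Function.Surjective (g'.comp (ContinuousLinearMap.inr ℝ V F)))
    {D : Set F} (hD : D ∈ 𝓝 η) : ∀ᶠ w in 𝓝 v, ∃ ζ ∈ D, g (w, ζ) = 0 := by
  -- The map `(v, η) ↦ (v, g (v, η))` has surjective derivative, hence is open at the point; the
  -- points `(w, 0)` near `(v, 0)` thus have preimages with second component in `D`.
  have hΦ : HasStrictFDerivAt (fun p : V × F => (p.1, g p))
      ((ContinuousLinearMap.fst ℝ V F).prod g') (v, η) := hasStrictFDerivAt_fst.prodMk hg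
  have hrange : ((ContinuousLinearMap.fst ℝ V F).prod g').range = ⊤ := by
    refine LinearMap.range_eq_top.2 fun p => ?_
    obtain ⟨ξ, hξ⟩ := hsurj (p.2 - g' (p.1, 0))
    refine ⟨(p.1, ξ), Prod.ext rfl ?_⟩
    have : ((p.1, ξ) : V × F) = (p.1, 0) + (0, ξ) := by simp
    change g' (p.1, ξ) = p.2
    rw [this, map_add]
    have hξ' : g' (0, ξ) = p.2 - g' (p.1, 0) := by simpa using hξ
    rw [hξ']; abel
  have hmap := hΦ.map_nhds_eq_of_surj hrange
  have hmem : (fun p : V × F => (p.1, g p)) '' {p | p.2 ∈ D} ∈ 𝓝 (v, (0 : F)) := by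
    rw [← h0, ← hmap]
    exact image_mem_map (continuous_snd.continuousAt.preimage_mem_nhds hD)
  have hlim : Tendsto (fun w : V => (w, (0 : F))) (𝓝 v) (𝓝 (v, 0)) :=
    (Continuous.prodMk_left (0 : F)).tendsto v
  filter_upwards [hlim hmem] with w hw
  obtain ⟨p, hp, hpw⟩ := hw
  have h1 : p.1 = w := congrArg Prod.fst hpw
  have h2 : g p = 0 := congrArg Prod.snd hpw
  exact ⟨p.2, hp, by rw [← h1]; exact h2⟩

/-- Zeros of a parametrized vector field on a compact set depend on the parameter in a Lipschitz
way, uniformly over a compact family of parameters with a unique nondegenerate zero. -/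
theorem exists_dist_zero_le [CompleteSpace V] [FiniteDimensional ℝ F]
    {G D Dstar : Set F} (hG : IsOpen G) (hD : IsCompact D) (hDs : IsCompact Dstar)
    (hint : Dstar ⊆ interior D) (hDG : D ⊆ G) {g : V × F → F}
    (hg : ContDiffOn ℝ 1 g (Set.univ ×ˢ G)) {Θ : Type*} {T : Set Θ} {m : Θ → V}
    (hm : IsCompact (m '' T)) {z : Θ → F} (hz : ∀ θ ∈ T, z θ ∈ Dstar ∧ g (m θ, z θ) = 0)
    (huniq : ∀ θ ∈ T, ∀ η ∈ D, g (m θ, η) = 0 → η = z θ)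
    (hdet : ∀ θ ∈ T, (fderiv ℝ (fun η => g (m θ, η)) (z θ)).det ≠ 0) :
    ∃ C : ℝ, 0 ≤ C ∧ ∀ θ ∈ T, ∀ w : V, ∀ η ∈ D, ((∃ ζ ∈ D, g (w, ζ) = 0) → g (w, η) = 0) →
      ‖η - z θ‖ ≤ C * ‖w - m θ‖ := by
  have : CompleteSpace F := FiniteDimensional.complete ℝ F
  by_contra hcon
  push Not at hcon
  -- If no constant works, `n ‖w n - m (θ n)‖ < ‖η n - z (θ n)‖` for suitable sequences. As `D` is
  -- bounded, this forces `w n - m (θ n) → 0`.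
  choose θ hθ w η hη hroot hlt using fun n : ℕ => hcon n (Nat.cast_nonneg n)
  have hDsD : Dstar ⊆ D := hint.trans interior_subset
  obtain ⟨R, hR⟩ := hD.isBounded.exists_norm_le
  have hdiff : ∀ n, ‖η n - z (θ n)‖ ≤ R + R := fun n =>
    (norm_sub_le _ _).trans (add_le_add (hR _ (hη n)) (hR _ (hDsD (hz _ (hθ n)).1)))
  have hR0 : 0 ≤ R := (norm_nonneg _).trans (hR _ (hη 0))
  have hwm : Tendsto (fun n => w n - m (θ n)) atTop (𝓝 0) := by
    rw [tendsto_zero_iff_norm_tendsto_zero]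
    refine squeeze_zero' (Eventually.of_forall fun n => norm_nonneg _) ?_
      (tendsto_const_div_atTop_nhds_zero_nat (R + R))
    filter_upwards [eventually_gt_atTop 0] with n hn
    rw [le_div_iff₀ (by exact_mod_cast hn), mul_comm]
    exact (hlt n).le.trans (hdiff n)
  obtain ⟨⟨v, η', ηs⟩, ⟨hv, hη', hηs⟩, φ, hφ, hlim⟩ :=
    (hm.prod (hD.prod hDs)).tendsto_subseq (x := fun n => (m (θ n), η n, z (θ n)))
      fun n => ⟨⟨θ n, hθ n, rfl⟩, hη n, (hz _ (hθ n)).1⟩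
  obtain ⟨θ₀, hθ₀, rfl⟩ := hv
  have hlm : Tendsto (fun n => m (θ (φ n))) atTop (𝓝 (m θ₀)) := (continuous_fst.tendsto _).comp hlim
  have hlη : Tendsto (fun n => η (φ n)) atTop (𝓝 η') :=
    ((continuous_fst.comp continuous_snd).tendsto _).comp hlim
  have hlz : Tendsto (fun n => z (θ (φ n))) atTop (𝓝 ηs) :=
    ((continuous_snd.comp continuous_snd).tendsto _).comp hlim
  have hlw : Tendsto (fun n => w (φ n)) atTop (𝓝 (m θ₀)) := by
    have := (hwm.comp hφ.tendsto_atTop).add hlm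
    simpa using this
  have hopen : IsOpen ((Set.univ : Set V) ×ˢ G) := isOpen_univ.prod hG
  have hcd : ∀ (v : V) (x : F), x ∈ D → ContDiffAt ℝ 1 g (v, x) := fun v x hx =>
    hg.contDiffAt (hopen.mem_nhds ⟨Set.mem_univ _, hDG hx⟩)
  -- No continuity of `z` is assumed: the limit of zeros is a zero at `m θ₀`, and uniqueness
  -- identifies it.
  have hηs0 : ηs = z θ₀ := by
    refine huniq θ₀ hθ₀ ηs (hDsD hηs) ?_
    have h1 := (hcd (m θ₀) ηs (hDsD hηs)).continuousAt.tendsto.comp (hlm.prodMk_nhds hlz)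
    refine tendsto_nhds_unique h1 (tendsto_const_nhds.congr fun n => ?_)
    exact (hz _ (hθ _)).2.symm
  subst hηs0
  set g' := fderiv ℝ g (m θ₀, z θ₀)
  have hstrict : HasStrictFDerivAt g g' (m θ₀, z θ₀) :=
    (hcd _ _ (hDsD hηs)).hasStrictFDerivAt one_ne_zero
  have hpart : fderiv ℝ (fun η => g (m θ₀, η)) (z θ₀) =
      g'.comp (ContinuousLinearMap.inr ℝ V F) :=
    (hstrict.hasFDerivAt.comp (z θ₀) (hasFDerivAt_prodMk_right (m θ₀) (z θ₀))).fderiv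
  set A := ContinuousLinearMap.toContinuousLinearEquivOfDetNeZero _ (hpart ▸ hdet θ₀ hθ₀)
  have hA : ∀ ξ, A ξ = g' (0, ξ) := fun ξ => by simp [A]
  have hev := eventually_exists_zero hstrict (hz θ₀ hθ₀).2
    (fun y => ⟨A.symm y, by
      have := A.apply_symm_apply y
      rw [hA] at this
      simpa using this⟩) (mem_interior_iff_mem_nhds.1 (hint hηs))
  -- Since `z θ₀` is interior to `D`, a zero in `D` persists for nearby `w`, which activates the
  -- defining property of `η n`.
  have hzero : ∀ᶠ n in atTop, g (w (φ n), η (φ n)) = 0 := by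
    filter_upwards [hlw hev] with n hn
    exact hroot _ hn
  have hη'0 : η' = z θ₀ := by
    refine huniq θ₀ hθ₀ η' hη' ?_
    have h1 := (hcd (m θ₀) η' hη').continuousAt.tendsto.comp (hlw.prodMk_nhds hlη)
    refine tendsto_nhds_unique h1 (tendsto_const_nhds.congr' ?_)
    filter_upwards [hzero] with n hn using hn.symm
  rw [hη'0] at hlη
  set a : ℝ := ‖(A.symm : F →L[ℝ] F)‖ + 1
  have ha : 0 < a := by positivity
  have hAinv : ∀ ξ, ‖ξ‖ ≤ a * ‖g' (0, ξ)‖ := fun ξ => by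
    have h1 := (A.symm : F →L[ℝ] F).le_opNorm (A ξ)
    rw [ContinuousLinearEquiv.coe_coe, A.symm_apply_apply, hA] at h1
    refine h1.trans (mul_le_mul_of_nonneg_right ?_ (norm_nonneg _))
    simp [a]
  have hpair : Tendsto (fun n => ((w (φ n), η (φ n)), (m (θ (φ n)), z (θ (φ n))))) atTop
      (𝓝 ((m θ₀, z θ₀), (m θ₀, z θ₀))) :=
    (hlw.prodMk_nhds hlη).prodMk_nhds (hlm.prodMk_nhds hlz)
  -- Strict differentiability compares two moving zeros. The tolerance `1 / (2 * a)` lets half of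
  -- `‖Δη‖` be absorbed on the left, leaving `‖Δη‖ ≤ (1 + 2 a ‖g'‖) ‖Δv‖`, against the assumed ratio
  -- larger than `φ n`.
  have hlittle := hpair.eventually (hstrict.isLittleO.def (show 0 < 1 / (2 * a) by positivity))
  have hbig : ∀ᶠ n in atTop, 1 + 2 * a * ‖g'‖ < φ n :=
    (tendsto_natCast_atTop_atTop.comp hφ.tendsto_atTop).eventually_gt_atTop _
  obtain ⟨n, hn0, hnl, hnb⟩ := (hzero.and (hlittle.and hbig)).exists
  set Δv := w (φ n) - m (θ (φ n))
  set Δη := η (φ n) - z (θ (φ n))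
  have h1 : ‖g' (Δv, Δη)‖ ≤ 1 / (2 * a) * ‖(Δv, Δη)‖ := by
    simp only [hn0, (hz _ (hθ _)).2, sub_self, zero_sub, norm_neg, Prod.mk_sub_mk] at hnl
    exact hnl
  have h2 : ‖(Δv, Δη)‖ ≤ ‖Δv‖ + ‖Δη‖ :=
    max_le (le_add_of_nonneg_right (norm_nonneg _)) (le_add_of_nonneg_left (norm_nonneg _))
  have h3 : ‖g' (0, Δη)‖ ≤ ‖g' (Δv, Δη)‖ + ‖g'‖ * ‖Δv‖ := by
    have h4 : ((0, Δη) : V × F) = (Δv, Δη) - (Δv, 0) := by simp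
    rw [h4, map_sub]
    refine (norm_sub_le _ _).trans (add_le_add le_rfl ((g'.le_opNorm _).trans_eq ?_))
    rw [Prod.norm_mk, norm_zero, max_eq_left (norm_nonneg _)]
  have h5 : ‖Δη‖ ≤ a * (1 / (2 * a) * (‖Δv‖ + ‖Δη‖) + ‖g'‖ * ‖Δv‖) := by
    refine (hAinv Δη).trans
      (mul_le_mul_of_nonneg_left (h3.trans (add_le_add (h1.trans ?_) le_rfl)) ha.le)
    exact mul_le_mul_of_nonneg_left h2 (by positivity)
  have h6 : a * (1 / (2 * a) * (‖Δv‖ + ‖Δη‖) + ‖g'‖ * ‖Δv‖) =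
      (‖Δv‖ + ‖Δη‖) / 2 + a * ‖g'‖ * ‖Δv‖ := by field_simp
  have h7 : (φ n : ℝ) * ‖Δv‖ < ‖Δη‖ := hlt (φ n)
  have h8 : (1 + 2 * a * ‖g'‖) * ‖Δv‖ ≤ φ n * ‖Δv‖ :=
    mul_le_mul_of_nonneg_right hnb.le (norm_nonneg _)
  linarith

end

/-! ### The quadratic criterion and its gradient -/

section

variable {M : ℕ}

lemma weightedSq_contDiff (K : Matrix (Fin M) (Fin M) ℂ) {n : WithTop ℕ∞} :
    ContDiff ℝ n (weightedSq K) := by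
  have hcoord : ∀ i : Fin M, ContDiff ℝ n fun v : Fin M → ℂ => v i := fun i => contDiff_apply ℝ ℂ i
  unfold weightedSq dotProduct Matrix.mulVec dotProduct
  refine Complex.reCLM.contDiff.comp (ContDiff.sum fun i _ => ContDiff.mul ?_ ?_)
  · exact (Complex.conjCLE.contDiff (𝕜 := ℝ)).comp (hcoord i)
  · exact ContDiff.sum fun j _ => contDiff_const.mul (hcoord j)

/-- The first cross term is conjugated, which leaves its real part unchanged; together they become
the real part of a complex linear functional of `a`, which vanishes in the mean when `a` is centred.
-/
lemma exists_weightedSq_add (K : Matrix (Fin M) (Fin M) ℂ) (b : Fin M → ℂ) :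
    ∃ s : Fin M → ℂ, ∀ a, weightedSq K (a + b) =
      weightedSq K a + weightedSq K b + (∑ k, a k * s k).re := by
  refine ⟨fun k => star (K⁻¹.mulVec b k) + Matrix.vecMul (star b) K⁻¹ k, fun a => ?_⟩
  have h1 : (star a ⬝ᵥ K⁻¹.mulVec b).re = (∑ k, a k * star (K⁻¹.mulVec b k)).re := by
    have : star (star a ⬝ᵥ K⁻¹.mulVec b) = ∑ k, a k * star (K⁻¹.mulVec b k) := by
      simp [dotProduct, star_sum]
    rw [← this]; simp
  have h2 : star b ⬝ᵥ K⁻¹.mulVec a = ∑ k, a k * Matrix.vecMul (star b) K⁻¹ k := by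
    rw [Matrix.dotProduct_mulVec]
    exact Finset.sum_congr rfl fun k _ => mul_comm _ _
  simp only [weightedSq, star_add, Matrix.mulVec_add, add_dotProduct, dotProduct_add,
    Complex.add_re, mul_add, Finset.sum_add_distrib]
  rw [h1, h2]
  ring

/-- Bias-variance decomposition: the dependence on `w` is entirely in the first term. -/
lemma integral_weightedSq_sub {Ω : Type*} [MeasurableSpace Ω] {P : Measure Ω}
    [IsProbabilityMeasure P] (K : Matrix (Fin M) (Fin M) ℂ) {E : Ω → Fin M → ℂ}
    (hE : AEStronglyMeasurable E P) (hbd : ∀ ω k, ‖E ω k‖ ≤ 1) (w : Fin M → ℂ) :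
    ∫ ω, weightedSq K (E ω - w) ∂P =
      weightedSq K ((fun k => ∫ ω, E ω k ∂P) - w) +
        ∫ ω, weightedSq K (E ω - fun k => ∫ ω, E ω k ∂P) ∂P := by
  set m : Fin M → ℂ := fun k => ∫ ω, E ω k ∂P
  have hEk : ∀ k, Integrable (fun ω => E ω k) P := fun k =>
    Integrable.of_bound (C := 1) ((continuous_apply k).comp_aestronglyMeasurable hE)
      (Eventually.of_forall fun ω => hbd ω k)
  obtain ⟨s, hs⟩ := exists_weightedSq_add K (m - w)
  have hdecomp : ∀ ω, weightedSq K (E ω - w) = weightedSq K (E ω - m) + weightedSq K (m - w) +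
      (∑ k, (E ω k - m k) * s k).re := fun ω => by
    have := hs (E ω - m)
    rw [sub_add_sub_cancel] at this
    exact this
  have hcont : Continuous (weightedSq K) := (weightedSq_contDiff K (n := 0)).continuous
  have hI1 : Integrable (fun ω => weightedSq K (E ω - m)) P := by
    obtain ⟨B, hB⟩ := (isCompact_closedBall (0 : Fin M → ℂ) (1 + ‖m‖)).exists_bound_of_continuousOn
      hcont.continuousOn
    refine Integrable.of_bound (C := B)
      (hcont.comp_aestronglyMeasurable (hE.sub aestronglyMeasurable_const))
      (Eventually.of_forall fun ω => hB _ ?_)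
    rw [mem_closedBall_zero_iff]
    refine (norm_sub_le _ _).trans (add_le_add ?_ le_rfl)
    exact (pi_norm_le_iff_of_nonneg zero_le_one).2 (hbd ω)
  have hI2 : Integrable (fun ω => ∑ k, (E ω k - m k) * s k) P :=
    integrable_finsetSum _ fun k _ => ((hEk k).sub (integrable_const _)).mul_const _
  have hzero : ∫ ω, (∑ k, (E ω k - m k) * s k).re ∂P = 0 := by
    have h1 : ∫ ω, (∑ k, (E ω k - m k) * s k).re ∂P =
        (∫ ω, ∑ k, (E ω k - m k) * s k ∂P).re := integral_re hI2
    have h2 : ∀ k ∈ Finset.univ, ∫ ω, (E ω k - m k) * s k ∂P = 0 := fun k _ => by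
      rw [integral_mul_const, integral_sub (hEk k) (integrable_const _)]
      simp [m]
    have h3 : ∀ k ∈ Finset.univ, Integrable (fun ω => (E ω k - m k) * s k) P := fun k _ =>
      ((hEk k).sub (integrable_const _)).mul_const _
    rw [h1, integral_finsetSum _ h3, Finset.sum_eq_zero h2, Complex.zero_re]
  have hI3 : Integrable (fun ω => (∑ k, (E ω k - m k) * s k).re) P := hI2.re
  have hI4 : Integrable (fun ω => weightedSq K (E ω - m) + weightedSq K (m - w)) P :=
    hI1.add (integrable_const _)
  simp_rw [hdecomp]
  rw [integral_add hI4 hI3, integral_add hI1 (integrable_const _), hzero]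
  simp only [integral_const, probReal_univ, one_smul, add_zero]
  ring

variable {F : Type*}

/-- The weighted distance of `v` from the model characteristic function. -/
noncomputable def misfit (K : Matrix (Fin M) (Fin M) ℂ) (φ : ℝ → F → ℂ) (u : Fin M → ℝ)
    (p : (Fin M → ℂ) × F) : ℝ :=
  weightedSq K (p.1 - fun k => φ (u k) p.2)

variable {K : Matrix (Fin M) (Fin M) ℂ} {φ : ℝ → F → ℂ} {u : Fin M → ℝ}

lemma empiricalCost_eq {N : ℕ} (hN : N ≠ 0) (ε : ℕ → ℝ) :
    empiricalCost φ u K N ε = fun η => misfit K φ u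
      ((fun k => (N : ℂ)⁻¹ * ∑ i ∈ Finset.range N, Complex.exp (Complex.I * u k * ε i)), η) := by
  have hN' : (N : ℂ) ≠ 0 := by exact_mod_cast hN
  funext η
  unfold empiricalCost misfit
  congr 1
  funext k
  simp only [score, Pi.smul_apply, Finset.sum_apply, Finset.sum_sub_distrib, Pi.sub_apply,
    smul_eq_mul, Finset.sum_const, Finset.card_range, nsmul_eq_mul, mul_sub]
  rw [inv_mul_cancel_left₀ hN']

variable [NormedAddCommGroup F] [InnerProductSpace ℝ F] {G : Set F}

lemma contDiffOn_misfit (hφ : ∀ k, ContDiffOn ℝ 2 (φ (u k)) G) :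
    ContDiffOn ℝ 2 (misfit K φ u) (Set.univ ×ˢ G) := by
  refine (weightedSq_contDiff K).comp_contDiffOn (contDiffOn_fst.sub (contDiffOn_pi.2 fun k => ?_))
  exact (hφ k).comp contDiffOn_snd fun p hp => hp.2

variable [CompleteSpace F]

/-- The gradient of the misfit in the parameter of the model. -/
noncomputable def misfitGrad (K : Matrix (Fin M) (Fin M) ℂ) (φ : ℝ → F → ℂ) (u : Fin M → ℝ)
    (p : (Fin M → ℂ) × F) : F :=
  (InnerProductSpace.toDual ℝ F).symm
    ((fderiv ℝ (misfit K φ u) p).comp (ContinuousLinearMap.inr ℝ (Fin M → ℂ) F))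

lemma contDiffOn_misfitGrad (hG : IsOpen G) (hφ : ∀ k, ContDiffOn ℝ 2 (φ (u k)) G) :
    ContDiffOn ℝ 1 (misfitGrad K φ u) (Set.univ ×ˢ G) := by
  -- The Riesz isometry is typed as conjugate-linear; over `ℝ` it is linear.
  have hlin : IsBoundedLinearMap ℝ (InnerProductSpace.toDual ℝ F).symm :=
    IsLinearMap.with_bound ⟨map_add _, fun c x => by simp⟩ 1 fun x => by simp
  refine hlin.contDiff.comp_contDiffOn (ContDiffOn.clm_comp ?_ contDiffOn_const)
  exact (contDiffOn_misfit hφ).fderiv_of_isOpen (isOpen_univ.prod hG) (by norm_num)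

lemma gradient_misfit (hG : IsOpen G) (hφ : ∀ k, ContDiffOn ℝ 2 (φ (u k)) G) (v : Fin M → ℂ)
    {η : F} (hη : η ∈ G) :
    gradient (fun ζ => misfit K φ u (v, ζ)) η = misfitGrad K φ u (v, η) := by
  have hd : DifferentiableAt ℝ (misfit K φ u) (v, η) :=
    ((contDiffOn_misfit hφ).contDiffAt
      ((isOpen_univ.prod hG).mem_nhds ⟨Set.mem_univ _, hη⟩)).differentiableAt (by norm_num)
  rw [gradient, misfitGrad]
  congr 1
  exact (hd.hasFDerivAt.comp η (hasFDerivAt_prodMk_right v η)).fderiv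

/-- The variance term does not involve `η`. The gradients agree as functions everywhere, so Hessians
may be compared as well. -/
lemma gradient_asymptoticCost {Ω : Type*} [MeasurableSpace Ω] {P : Measure Ω}
    [IsProbabilityMeasure P] {ε : Ω → ℝ} (hε : AEStronglyMeasurable ε P) :
    gradient (asymptoticCost P φ u K ε) =
      gradient (fun η => misfit K φ u
        ((fun k => ∫ ω, Complex.exp (Complex.I * u k * ε ω) ∂P), η)) := by
  have hcost : asymptoticCost P φ u K ε = fun η => misfit K φ u
      ((fun k => ∫ ω, Complex.exp (Complex.I * u k * ε ω) ∂P), η) +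
      ∫ ω, weightedSq K ((fun k => Complex.exp (Complex.I * u k * ε ω)) -
        fun k => ∫ ω, Complex.exp (Complex.I * u k * ε ω) ∂P) ∂P := by
    funext η
    have hcont : Continuous fun x : ℝ => fun k => Complex.exp (Complex.I * u k * (x : ℂ)) := by
      fun_prop
    exact integral_weightedSq_sub K (E := fun ω k => Complex.exp (Complex.I * u k * ε ω))
      (hcont.comp_aestronglyMeasurable hε) (fun ω k => (norm_exp_I_mul_ofReal _ _).le)
      (fun k => φ (u k) η)
  rw [hcost]
  funext η
  rw [gradient, gradient, fderiv_add_const]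

end

/-! ### Application to the estimated innovations -/

lemma innovation_output_sub_filtSum {Ω Θ : Type*} {d : ℕ} (S : InnovationModel Θ d) (θ θ' : Θ)
    (x₁ : Ω → Fin d → ℝ) (e : ℤ → Ω → ℝ) (k : ℕ) (ω : Ω) :
    S.innovation θ (S.output θ' (x₁ ω) fun n => e n ω) k =
      filtSum (S.filtCoeff θ θ') e k (k + 1) ω + ∑ i ∈ Finset.range (k + 1),
        S.invCoeff θ i * (S.L θ' ⬝ᵥ (S.H θ' ^ (k - i)).mulVec (x₁ ω)) :=
  S.innovation_output_eq θ θ' (x₁ ω) (fun n => e n ω) k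

section

variable {Ω : Type*} [MeasurableSpace Ω] {P : Measure Ω}

lemma IsNoise.statInverse_ae_eq {e : ℤ → Ω → ℝ} {A : ℝ} {χ : ℝ → ℂ} (he : IsNoise P e A χ)
    {Θ : Type*} {d : ℕ} {S : InnovationModel Θ d} {D : Set Θ} {θ' : Θ} {C ρ : ℝ}
    (hS : FilterBounds S D θ' C ρ) {θ : Θ} (hθ : θ ∈ D) :
    (fun ω => S.statInverse θ (S.statOutput θ' fun n => e n ω) 1) =ᵐ[P]
      fun ω => ∑' l : ℕ, S.filtCoeff θ θ' l * e (1 - (l : ℤ)) ω := by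
  have hg := summable_geometric_of_lt_one hS.rate_pos.le hS.rate_lt_one
  have hw : Summable fun p : ℕ × ℕ => ρ ^ (p.1 + p.2) := by
    simp_rw [pow_add]
    exact hg.mul_of_nonneg hg (fun i => pow_nonneg hS.rate_pos.le i)
      fun i => pow_nonneg hS.rate_pos.le i
  filter_upwards [he.ae_summable (w := fun p : ℕ × ℕ => ρ ^ (p.1 + p.2))
    (fun p => pow_nonneg hS.rate_pos.le _) hw (fun p => 1 - ((p.1 + p.2 : ℕ) : ℤ))] with ω hω
  exact S.statInverse_statOutput_eq θ θ' hS.rate_pos (hS.inv θ hθ) hS.out hω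

lemma IsNoise.aestronglyMeasurable_innovation {e : ℤ → Ω → ℝ} {A : ℝ} {χ : ℝ → ℂ}
    (he : IsNoise P e A χ) {Θ : Type*} {d : ℕ} (S : InnovationModel Θ d) (θ θ' : Θ)
    {x₁ : Ω → Fin d → ℝ} (hx₁ : AEStronglyMeasurable x₁ P) (k : ℕ) :
    AEStronglyMeasurable
      (fun ω => S.innovation θ (S.output θ' (x₁ ω) fun n => e n ω) k) P := by
  simp_rw [innovation_output_sub_filtSum]
  refine AEStronglyMeasurable.add
    (measurable_filtSum _ k _ fun _ _ => he.measurable _).aestronglyMeasurable ?_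
  have : Continuous fun v : Fin d → ℝ => ∑ i ∈ Finset.range (k + 1),
      S.invCoeff θ i * (S.L θ' ⬝ᵥ (S.H θ' ^ (k - i)).mulVec v) := by fun_prop
  exact this.comp_aestronglyMeasurable hx₁

variable [IsProbabilityMeasure P]

lemma IsLevyProcess.isNoise {Z : ℝ → Ω → ℝ} {b : ℝ} {ν : Measure ℝ} (hZ : IsLevyProcess P Z b ν)
    (hν : IsLevyMeasure ν)
    (hmom : ∫⁻ x in {x : ℝ | 1 ≤ |x|}, ENNReal.ofReal (|x| ^ (2 : ℝ)) ∂ν < ⊤)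
    {h : ℝ} (hh : 0 ≤ h) :
    IsNoise P (fun n : ℤ => increment Z h n) (∫ ω, |increment Z h 0 ω| ∂P)
      (fun u => Complex.exp (h * charExponent b ν u)) where
  measurable := hZ.measurable_increment h
  indep := hZ.iIndepFun_increment hh
  integrable := hZ.integrable_increment hν hmom hh
  integral_abs_le n := (hZ.integral_abs_increment hh n).le
  charFun n u := hZ.integral_exp_increment hh n u

lemma IsNoise.continuous_charFun {e : ℤ → Ω → ℝ} {A : ℝ} {χ : ℝ → ℂ} (he : IsNoise P e A χ) :
    Continuous χ := by
  have hχ : χ = fun u : ℝ => ∫ ω, Complex.exp (Complex.I * u * (e 0 ω : ℂ)) ∂P :=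
    funext fun u => (he.charFun 0 u).symm
  rw [hχ]
  refine continuous_of_dominated (bound := fun _ => 1) (fun u => ?_) (fun u => ?_)
    (integrable_const _) (Eventually.of_forall fun ω => by fun_prop)
  · exact (integrable_exp_I_mul (he.measurable 0).aestronglyMeasurable u).aestronglyMeasurable
  · exact Eventually.of_forall fun ω => (norm_exp_I_mul_ofReal _ _).le

/-- Continuity in the parameter of the characteristic function of an infinite moving average. -/
lemma IsNoise.continuousOn_integral_exp_tsum {e : ℤ → Ω → ℝ} {A : ℝ} {χ : ℝ → ℂ}
    (he : IsNoise P e A χ) {E : Type*} [TopologicalSpace E] {D : Set E} {c : E → ℕ → ℝ} {C ρ : ℝ}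
    (hC : 0 ≤ C) (hρ0 : 0 < ρ) (hρ1 : ρ < 1) (hc : ∀ θ ∈ D, ∀ l, |c θ l| ≤ C * ρ ^ l)
    (hcont : ∀ l, ContinuousOn (fun θ => c θ l) D) (u : ℝ) :
    ContinuousOn (fun θ => ∫ ω, Complex.exp (Complex.I * u *
      ((∑' l : ℕ, c θ l * e (1 - (l : ℤ)) ω : ℝ) : ℂ)) ∂P) D := by
  have hlim : Tendsto (fun N : ℕ => |u| * (C * A / (1 - ρ)) * ρ ^ N) atTop (𝓝 0) := by
    simpa using (tendsto_pow_atTop_nhds_zero_of_lt_one hρ0.le hρ1).const_mul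
      (|u| * (C * A / (1 - ρ)))
  -- The characteristic function of the infinite moving average is a uniform limit of finite
  -- products, each continuous in the parameter.
  have hunif : TendstoUniformlyOn (fun (N : ℕ) θ => ∏ l ∈ Finset.range N, χ (u * c θ l))
      (fun θ => ∫ ω, Complex.exp (Complex.I * u *
        ((∑' l : ℕ, c θ l * e (1 - (l : ℤ)) ω : ℝ) : ℂ)) ∂P) atTop D := by
    rw [Metric.tendstoUniformlyOn_iff]
    intro δ hδ
    filter_upwards [hlim.eventually_lt_const hδ] with N hN θ hθ
    rw [dist_eq_norm]
    exact (he.norm_integral_exp_tsum_sub_le hC hρ0 hρ1 (hc θ hθ) u N).trans_lt hN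
  refine hunif.continuousOn (Eventually.frequently (Eventually.of_forall fun N => ?_))
  exact continuousOn_finsetProd _ fun l _ =>
    he.continuous_charFun.comp_continuousOn ((hcont l).const_mul u)

/-- The empirical characteristic function of the estimated innovations converges to that of the
stationary innovation at rate `N^{-1/2}`, uniformly in the parameter. -/
lemma IsNoise.exists_eLpNorm_sum_exp_innovation_le {e : ℤ → Ω → ℝ} {A : ℝ} {χ : ℝ → ℂ}
    (he : IsNoise P e A χ) {Θ : Type*} {d : ℕ} {S : InnovationModel Θ d} {D : Set Θ} {θ' : Θ}
    {C ρ : ℝ} (hS : FilterBounds S D θ' C ρ) {x₁ : Ω → Fin d → ℝ} (hx₁ : Integrable x₁ P) (q : ℕ)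
    (u : ℝ) :
    ∃ B : ℝ, 0 ≤ B ∧ ∀ θ ∈ D, ∀ N : ℕ, 1 ≤ N →
      eLpNorm (fun ω => ∑ k ∈ Finset.range N, (Complex.exp (Complex.I * u *
        S.innovation θ (S.output θ' (x₁ ω) fun n => e n ω) k) -
        ∫ ω, Complex.exp (Complex.I * u *
          S.statInverse θ (S.statOutput θ' fun n => e n ω) 1) ∂P))
        ((2 * q + 2 : ℕ) : ENNReal) P ≤ ENNReal.ofReal (B * √N) := by
  obtain ⟨B, hB, h⟩ := exists_eLpNorm_sum_exp_sub_le (P := P) q u he.nonneg hS.const_pos.le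
    hS.rate_pos hS.rate_lt_one hx₁.norm (fun ω => norm_nonneg (x₁ ω))
  refine ⟨B, hB, fun θ hθ N hN => ?_⟩
  have hm : ∫ ω, Complex.exp (Complex.I * u *
      S.statInverse θ (S.statOutput θ' fun n => e n ω) 1) ∂P =
      ∫ ω, Complex.exp (Complex.I * u *
        ((∑' l : ℕ, S.filtCoeff θ θ' l * e (1 - (l : ℤ)) ω : ℝ) : ℂ)) ∂P := by
    refine integral_congr_ae ?_
    filter_upwards [he.statInverse_ae_eq hS hθ] with ω hω
    rw [hω]
  rw [hm]
  refine h (S.filtCoeff θ θ') e χ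
    (fun k ω => S.innovation θ (S.output θ' (x₁ ω) fun n => e n ω) k) he (hS.filt θ hθ)
    (fun k => he.aestronglyMeasurable_innovation S θ θ' hx₁.aestronglyMeasurable k)
    (fun k ω => ?_) N hN
  rw [innovation_output_sub_filtSum, add_sub_cancel_left]
  exact hS.init θ hθ k (x₁ ω)

lemma eLpNorm_le_of_norm_le_sum {M n N : ℕ} {E : Type*} [NormedAddCommGroup E]
    {q : ENNReal} (hq : q ≤ n) (hn : 1 ≤ n) {X : Ω → E}
    {Y : Fin M → Ω → ℂ} (hY : ∀ k, AEStronglyMeasurable (Y k) P) {C : ℝ} (hC : 0 ≤ C)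
    {B : Fin M → ℝ} (hB : ∀ k, 0 ≤ B k) (hN : 1 ≤ N)
    (hYB : ∀ k, eLpNorm (Y k) n P ≤ ENNReal.ofReal (B k * √N))
    (hXY : ∀ ω, ‖X ω‖ ≤ C * ∑ k, (N : ℝ)⁻¹ * ‖Y k ω‖) :
    eLpNorm X q P ≤ ENNReal.ofReal (C * (∑ k, B k) * (N : ℝ) ^ (-(1 / 2 : ℝ))) := by
  have hN0 : (0 : ℝ) < N := by exact_mod_cast hN
  have hsm : ∀ k, AEStronglyMeasurable (((N : ℝ)⁻¹) • fun ω => ‖Y k ω‖) P := fun k =>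
    (hY k).norm.const_smul _
  set T : Ω → ℝ := C • ∑ k, ((N : ℝ)⁻¹) • fun ω => ‖Y k ω‖
  have hT : AEStronglyMeasurable T P :=
    (Finset.aestronglyMeasurable_sum _ fun k _ => hsm k).const_smul C
  have hXT : eLpNorm X q P ≤ eLpNorm T q P := by
    refine eLpNorm_mono_real fun ω => (hXY ω).trans_eq ?_
    simp [T, Finset.sum_apply]
  refine hXT.trans ((eLpNorm_le_eLpNorm_of_exponent_le hq hT).trans ?_)
  have hp : (1 : ENNReal) ≤ (n : ENNReal) := by exact_mod_cast hn
  have hterm : ∀ k, eLpNorm (((N : ℝ)⁻¹) • fun ω => ‖Y k ω‖) n P ≤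
      ENNReal.ofReal (B k * (N : ℝ) ^ (-(1 / 2 : ℝ))) := by
    intro k
    rw [eLpNorm_const_smul, eLpNorm_norm, Real.enorm_eq_ofReal (by positivity)]
    refine (mul_le_mul' le_rfl (hYB k)).trans_eq ?_
    rw [← ENNReal.ofReal_mul (by positivity)]
    congr 1
    rw [Real.rpow_neg hN0.le, ← Real.sqrt_eq_rpow]
    have h1 : √(N : ℝ) * √N = N := Real.mul_self_sqrt hN0.le
    have h2 : 0 < √(N : ℝ) := Real.sqrt_pos.2 hN0
    field_simp
    rw [sq]; linear_combination (B k) * h1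
  rw [eLpNorm_const_smul, Real.enorm_eq_ofReal hC]
  calc _ ≤ ENNReal.ofReal C * ∑ k, ENNReal.ofReal (B k * (N : ℝ) ^ (-(1 / 2 : ℝ))) :=
        mul_le_mul' le_rfl ((eLpNorm_sum_le (fun k _ => hsm k) hp).trans
          (Finset.sum_le_sum fun k _ => hterm k))
    _ = _ := by
        rw [← ENNReal.ofReal_sum_of_nonneg fun k _ => mul_nonneg (hB k) (by positivity),
          ← ENNReal.ofReal_mul hC, ← Finset.sum_mul, mul_assoc]

end

end LevyECF

/-! ### The main theorem -/

open LevyECF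
theorem mainTheorem6
    {Ω : Type*} [MeasurableSpace Ω] (P : Measure Ω) [IsProbabilityMeasure P]
    (p r d M : ℕ)
    -- parameter sets and true parameters
    (Gθ Dθ Dθstar : Set (EuclideanSpace ℝ (Fin p))) (θstar : EuclideanSpace ℝ (Fin p))
    (hDθ : IsDomainChain Gθ Dθ Dθstar θstar)
    (Gη Dη Dηstar : Set (EuclideanSpace ℝ (Fin r))) (ηtrue : EuclideanSpace ℝ (Fin r))
    (hGη : IsOpen Gη) (hDη : IsDomainChain Gη Dη Dηstar ηtrue)
    -- the noise: increments of a Lévy process with Lévy measure `ν ηtrue`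
    (b : EuclideanSpace ℝ (Fin r) → ℝ) (ν : EuclideanSpace ℝ (Fin r) → Measure ℝ)
    (hν : ∀ η ∈ Gη, IsLevyMeasure (ν η))
    (Z : ℝ → Ω → ℝ) (hZ : IsLevyProcess P Z (b ηtrue) (ν ηtrue))
    (h : ℝ) (hh : 0 < h)
    -- the system, depending continuously on `θ`, with arbitrary initial state
    (S : InnovationModel (EuclideanSpace ℝ (Fin p)) d)
    (hSH : ContinuousOn S.H Dθ) (hSK : ContinuousOn S.K Dθ) (hSL : ContinuousOn S.L Dθ)
    (x₁ : Ω → Fin d → ℝ) (hx₁ : ∀ q : ℝ, 1 ≤ q → MemLp x₁ (ENNReal.ofReal q) P)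
    -- Condition 1: stability and inverse stability
    (hstab : ∀ θ ∈ Gθ, IsStable (S.H θ) ∧ IsStable (S.invH θ))
    -- Condition 2: moments of the Lévy measure, and centred noise
    (hmom : ∀ q : ℝ, 1 ≤ q →
      ∫⁻ x in {x : ℝ | 1 ≤ |x|}, ENNReal.ofReal (|x| ^ q) ∂(ν ηtrue) < ⊤)
    (hmean : ∀ n : ℤ, ∫ ω, increment Z h n ω ∂P = 0)
    -- the criterion: nodes, smooth characteristic functions, weighting matrix
    (u : Fin M → ℝ)
    (hφ : ∀ k, ContDiffOn ℝ 2 (noiseCF b ν h (u k)) Gη)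
    (K : Matrix (Fin M) (Fin M) ℂ) (hK : K.PosDef)
    -- the asymptotic cost at the stationary innovation
    (W : EuclideanSpace ℝ (Fin p) → EuclideanSpace ℝ (Fin r) → ℝ)
    (hW : W = fun θ => asymptoticCost P (noiseCF b ν h) u K
      (fun ω => S.statInverse θ (S.statOutput θstar (fun n => increment Z h n ω)) 1))
    -- Condition 3: unique root of the asymptotic gradient equation, with nonsingular Hessian
    (ηstar : EuclideanSpace ℝ (Fin p) → EuclideanSpace ℝ (Fin r))
    (hroot : ∀ θ ∈ Dθ, ηstar θ ∈ Dηstar ∧ gradient (W θ) (ηstar θ) = 0)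
    (huniq : ∀ θ ∈ Dθ, ∀ η ∈ Dη, gradient (W θ) η = 0 → η = ηstar θ)
    (hHess : ∀ θ ∈ Dθ, (fderiv ℝ (gradient (W θ)) (ηstar θ)).det ≠ 0)
    -- the estimator computed from the observations `Δy_1, …, Δy_N`
    (ηhat : ℕ → EuclideanSpace ℝ (Fin p) → Ω → EuclideanSpace ℝ (Fin r))
    (hηhat : ∀ N : ℕ, 1 ≤ N → ∀ θ ∈ Dθ, IsGradientEstimator
      (fun ω => empiricalCost (noiseCF b ν h) u K N
        (S.innovation θ (S.output θstar (x₁ ω) (fun n => increment Z h n ω))))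
      Dη (ηhat N θ)) :
    IsOM P Dθ (fun N θ ω => ηhat N θ ω - ηstar θ) (fun N => (N : ℝ) ^ (-(1 / 2 : ℝ))) := by
  have hDθD : θstar ∈ Dθ := interior_subset (hDθ.subset_interior hDθ.mem)
  have hηG : ηtrue ∈ Gη := hDη.subset (interior_subset (hDη.subset_interior hDη.mem))
  obtain ⟨C, ρ, hS⟩ := exists_filterBounds S hDθ.compact hSH hSK hSL hDθD
    fun θ hθ => hstab θ (hDθ.subset hθ)
  have he := hZ.isNoise (hν ηtrue hηG) (hmom 2 one_le_two) hh.le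
  set e : ℤ → Ω → ℝ := fun n => increment Z h n
  set φ := noiseCF b ν h
  set εs : EuclideanSpace ℝ (Fin p) → Ω → ℝ := fun θ ω =>
    S.statInverse θ (S.statOutput θstar fun n => e n ω) 1
  set m : EuclideanSpace ℝ (Fin p) → Fin M → ℂ := fun θ k =>
    ∫ ω, Complex.exp (Complex.I * u k * εs θ ω) ∂P with hm
  have hεs : ∀ θ ∈ Dθ, AEStronglyMeasurable (εs θ) P := fun θ hθ =>
    (he.lintegral_tsum_sub_filtSum_le hS.const_pos.le hS.rate_pos hS.rate_lt_one
      (hS.filt θ hθ)).1.congr (he.statInverse_ae_eq hS hθ).symm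
  -- Continuity makes `m '' Dθ` compact, as the deterministic Lipschitz bound requires.
  have hmcont : ContinuousOn m Dθ := by
    refine continuousOn_pi.2 fun k => ?_
    refine (he.continuousOn_integral_exp_tsum hS.const_pos.le hS.rate_pos hS.rate_lt_one hS.filt
      (continuousOn_filtCoeff S hSH hSK hSL θstar) (u k)).congr fun θ hθ => ?_
    refine integral_congr_ae ?_
    filter_upwards [he.statInverse_ae_eq hS hθ] with ω hω
    simp only [εs]
    rw [hω]
  have hgradW : ∀ θ ∈ Dθ, gradient (W θ) = gradient fun η => misfit K φ u (m θ, η) := by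
    intro θ hθ
    rw [hW]
    exact gradient_asymptoticCost (hεs θ hθ)
  have hgW : ∀ θ ∈ Dθ, ∀ η ∈ Gη, gradient (W θ) η = misfitGrad K φ u (m θ, η) := by
    intro θ hθ η hη
    rw [hgradW θ hθ]
    exact gradient_misfit hGη hφ (m θ) hη
  have hstarG : ∀ θ ∈ Dθ, ηstar θ ∈ Gη := fun θ hθ =>
    hDη.subset (interior_subset (hDη.subset_interior (hroot θ hθ).1))
  obtain ⟨C', hC', hlip⟩ := exists_dist_zero_le hGη hDη.compact hDη.compact_star
    hDη.subset_interior hDη.subset (contDiffOn_misfitGrad (K := K) hGη hφ)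
    (hDθ.compact.image_of_continuousOn hmcont) (z := ηstar)
    (fun θ hθ => ⟨(hroot θ hθ).1, by
      rw [← hgW θ hθ _ (hstarG θ hθ)]; exact (hroot θ hθ).2⟩)
    (fun θ hθ η hη h0 => huniq θ hθ η hη (by rw [hgW θ hθ η (hDη.subset hη)]; exact h0))
    (fun θ hθ => by
      have hev : gradient (W θ) =ᶠ[𝓝 (ηstar θ)] fun η => misfitGrad K φ u (m θ, η) := by
        filter_upwards [hGη.mem_nhds (hstarG θ hθ)] with η hη using hgW θ hθ η hη
      rw [← hev.fderiv_eq]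
      exact hHess θ hθ)
  intro q hq
  obtain ⟨n, hn⟩ := exists_nat_ge q
  have hx₁' : Integrable x₁ P := memLp_one_iff_integrable.1 (by simpa using hx₁ 1 le_rfl)
  choose B hB hBN using fun k => he.exists_eLpNorm_sum_exp_innovation_le hS hx₁' n (u k)
  refine ⟨C' * ∑ k, B k, fun N hN θ hθ => ?_⟩
  have hN0 : N ≠ 0 := by omega
  set ε : Ω → ℕ → ℝ := fun ω => S.innovation θ (S.output θstar (x₁ ω) fun n => e n ω)
  have hεm : ∀ k, AEStronglyMeasurable (fun ω => ε ω k) P :=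
    he.aestronglyMeasurable_innovation S θ θstar hx₁'.aestronglyMeasurable
  refine eLpNorm_le_of_norm_le_sum (n := 2 * n + 2) (N := N)
    (Y := fun k ω => ∑ i ∈ Finset.range N, (Complex.exp (Complex.I * u k * ε ω i) - m θ k))
    ?_ (by omega) (fun k => ?_) hC' hB hN (fun k => hBN k θ hθ N hN) (fun ω => ?_)
  · rw [← ENNReal.ofReal_natCast]
    exact ENNReal.ofReal_le_ofReal (hn.trans (by push_cast; linarith [n.cast_nonneg (α := ℝ)]))
  · exact Finset.aestronglyMeasurable_fun_sum _ fun i _ =>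
      ((integrable_exp_I_mul (hεm i) (u k)).sub (integrable_const _)).aestronglyMeasurable
  · have hest := hηhat N hN θ hθ
    set w : Fin M → ℂ := fun k =>
      (N : ℂ)⁻¹ * ∑ i ∈ Finset.range N, Complex.exp (Complex.I * u k * ε ω i)
    have hgrad : ∀ η ∈ Dη, gradient (empiricalCost φ u K N (ε ω)) η = misfitGrad K φ u (w, η) := by
      intro η hη
      rw [empiricalCost_eq hN0]
      exact gradient_misfit hGη hφ w (hDη.subset hη)
    -- The Lipschitz bound holds for each `ω` separately; on `Dη` the empirical gradient equation is
    -- the equation `misfitGrad K φ u (w, ·) = 0`, so the defining property of the estimator is the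
    -- one required.
    refine (hlip θ hθ w (ηhat N θ ω) (hest.mem ω) ?_).trans ?_
    · rintro ⟨ζ, hζ, hζ0⟩
      rw [← hgrad _ (hest.mem ω)]
      exact hest.root ω ⟨ζ, hζ, by rw [← hζ0]; exact hgrad ζ hζ⟩
    · refine mul_le_mul_of_nonneg_left ?_ hC'
      have hcoord : ∀ k, ‖(w - m θ) k‖ = (N : ℝ)⁻¹ *
          ‖∑ i ∈ Finset.range N, (Complex.exp (Complex.I * u k * ε ω i) - m θ k)‖ := by
        intro k
        have hN' : (N : ℂ) ≠ 0 := by exact_mod_cast hN0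
        have h1 : (w - m θ) k = (N : ℂ)⁻¹ *
            ∑ i ∈ Finset.range N, (Complex.exp (Complex.I * u k * ε ω i) - m θ k) := by
          rw [Finset.sum_sub_distrib, mul_sub, Finset.sum_const, Finset.card_range, nsmul_eq_mul,
            inv_mul_cancel_left₀ hN']
          rfl
        rw [h1, norm_mul, norm_inv, Complex.norm_natCast]
      simp_rw [← hcoord]
      refine (pi_norm_le_iff_of_nonneg (Finset.sum_nonneg fun k _ => norm_nonneg _)).2 fun k => ?_
      exact Finset.single_le_sum (f := fun k => ‖(w - m θ) k‖) (fun k _ => norm_nonneg _)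
        (Finset.mem_univ k)
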